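/- Let $N\ge 1$, $0<s<1$ and $2\le q\le p<\infty$. Write $B_r=\{x\in\mathbb R^N:|x|<r\}$ and $J_m(t)=|t|^{m-2}t$. For a bounded set $\Omega\subset\mathbb R^N$ and $m\in\{p,q\}$ let $\widetilde W^{s,m}(\Omega)$ be the space of all $u\in L^m_{\rm loc}(\mathbb R^N)$ such that $$\int_{\mathbb R^N}\frac{|u(x)|^{m-1}}{(1+|x|)^{N+sm}}\,dx<\infty$$ and, for some open set $U\supset\overline\Omega$, $$u\in L^m(U)\quad\text{and}\quad \int_U\int_U\frac{|u(x)-u(y)|^m}{|x-y|^{N+sm}}\,dx\,dy<\infty .$$ For $u\in\widetilde W^{s,p}(\Omega)\cap\widetilde W^{s,q}(\Omega)$ and a constant $K\ge0$, the inequality $(-\Delta_p)^su+(-\Delta_q)^su\ge -K$ holds weakly in $\Omega$ if $$\sum_{m=p,q}\int_{\mathbb R^N}\int_{\mathbb R^N}\frac{J_m(u(x)-u(y))(\varphi(x)-\varphi(y))}{|x-y|^{N+sm}}\,dx\,dy\ \ge\ -K\int_\Omega\varphi\,dx\qquad\text{for all }\varphi\in C_0^\infty(\Omega),\ \varphi\ge0$$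 (for $p=q$ the sum has two equal terms). **Theorem (weak Harnack inequality).** There are constants $\sigma\in(0,1)$ and $\overline C>0$, depending only on $N,s,p,q$, such that for all $R>0$, all $K\ge0$ and every $u\in\widetilde W^{s,p}(B_{R/3})\cap\widetilde W^{s,q}(B_{R/3})$ with $u\ge0$ a.e. in $\mathbb R^N$ and $(-\Delta_p)^su+(-\Delta_q)^su\ge-K$ weakly in $B_{R/3}$, $$\operatorname*{ess\,inf}_{B_{R/4}}u\ \ge\ \sigma\left(\frac1{|B_R\setminus B_{R/2}|}\int_{B_R\setminus B_{R/2}}u^{q-1}\,dx\right)^{1/(q-1)}-\overline C\,\bigl(KR^{sp}\bigr)^{1/(p-1)} .$$ -/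

import Mathlib

open MeasureTheory
open scoped ContDiff

namespace FracPQ

noncomputable section

/-- The space `ℝ^N` with its Euclidean norm. -/
abbrev Space (N : ℕ) : Type := EuclideanSpace ℝ (Fin N)

/-- `J_m(t) = |t|^(m-2) t`. -/
def J (m t : ℝ) : ℝ := |t| ^ (m - 2) * t

/-- The `m`-th power of the Gagliardo seminorm of `u` on `U`,
`∫_U ∫_U |u(x) - u(y)|^m / |x - y|^(N + s m) dx dy`, as an element of `[0, ∞]`. -/
def gagliardo {N : ℕ} (s m : ℝ) (U : Set (Space N)) (u : Space N → ℝ) : ENNReal :=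
  ∫⁻ x in U, ∫⁻ y in U, ENNReal.ofReal (|u x - u y| ^ m / ‖x - y‖ ^ ((N : ℝ) + s * m))

/-- Membership in the fractional Sobolev space `W^{s,m}(U)`. -/
def MemW {N : ℕ} (s m : ℝ) (U : Set (Space N)) (u : Space N → ℝ) : Prop :=
  MemLp u (ENNReal.ofReal m) (volume.restrict U) ∧ gagliardo s m U u < ⊤

/-- Membership in `L^m_loc(ℝ^N)`. -/
def MemLmLoc {N : ℕ} (m : ℝ) (u : Space N → ℝ) : Prop :=
  ∀ A : Set (Space N), IsCompact A → MemLp u (ENNReal.ofReal m) (volume.restrict A)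

/-- The weighted integral `∫ |u(x)|^(m-1) / (1 + |x|)^(N + s m) dx` over `ℝ^N`. -/
def tailWeight {N : ℕ} (s m : ℝ) (u : Space N → ℝ) : ENNReal :=
  ∫⁻ x, ENNReal.ofReal (|u x| ^ (m - 1) / (1 + ‖x‖) ^ ((N : ℝ) + s * m))

/-- Membership in the space written `W` with a tilde, `W^{s,m}` tilde of a bounded set `Ω`:
`u` is in `L^m_loc(ℝ^N)`, has finite weighted integral, and lies in `W^{s,m}(U)` for some open
set `U` that contains the compact closure of `Ω`. -/
def MemWTilde {N : ℕ} (s m : ℝ) (Ω : Set (Space N)) (u : Space N → ℝ) : Prop :=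
  MemLmLoc m u ∧ tailWeight s m u < ⊤ ∧
    ∃ U : Set (Space N), IsOpen U ∧ IsCompact (closure Ω) ∧ closure Ω ⊆ U ∧ MemW s m U u

/-- The weak form of the fractional `m`-Laplacian,
`∫∫ J_m(u(x) - u(y)) (φ(x) - φ(y)) / |x - y|^(N + s m) dx dy` over `ℝ^N × ℝ^N`.
For `u` in the tilde space of `Ω` and `φ` a test function in `Ω` the integrand is
Lebesgue integrable, so this is a genuine integral. -/
def weakForm {N : ℕ} (s m : ℝ) (u φ : Space N → ℝ) : ℝ :=
  ∫ z : Space N × Space N,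
    J m (u z.1 - u z.2) * (φ z.1 - φ z.2) / ‖z.1 - z.2‖ ^ ((N : ℝ) + s * m)

/-- `φ` is a smooth function with compact support inside `Ω`. -/
def IsTestFunction {N : ℕ} (Ω : Set (Space N)) (φ : Space N → ℝ) : Prop :=
  ContDiff ℝ ∞ φ ∧ HasCompactSupport φ ∧ tsupport φ ⊆ Ω

/-- `u` belongs to both tilde spaces (for `m = p` and `m = q`) of the bounded set `Ω` and
satisfies `(-Δ_p)^s u + (-Δ_q)^s u ≥ f` weakly in `Ω`. -/
def IsWeakSupersolution {N : ℕ} (s p q : ℝ) (Ω : Set (Space N)) (f u : Space N → ℝ) : Prop :=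
  MemWTilde s p Ω u ∧ MemWTilde s q Ω u ∧
    ∀ φ : Space N → ℝ, IsTestFunction Ω φ → (∀ x, 0 ≤ φ x) →
      ∫ x in Ω, f x * φ x ≤ weakForm s p u φ + weakForm s q u φ

end

end FracPQ

namespace FracPQ

open Filter Topology Metric

/-! ### The function `J` -/

/-! The proof is a barrier argument that exploits nonlocality. Let `v` be a smooth bump of height
`ℓ`, equal to `ℓ` on `B_{R/4}` and supported in `B_{3R/10}`, and test the inequality with `η = (v -
u)⁺`. Monotonicity of `J m` lets `u` be replaced by `v` in the form. For pairs with one point `y` in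
the annulus, where `v` and `η` vanish, the large values of `u y` give an additional negative term.
With `A` the average of `u ^ (m - 1)` over the annulus, each `m ∈ {p, q}` satisfies

form of `u` against `η` ≤ `R ^ (-s m) * (C ℓ ^ (m - 1) - c A) * ∫ η`

(`exists_integral_formIntegrand_barrier_le`). Here `C` comes partly from the form of `v`:
symmetrizing its increments produces second differences, which the kernel can integrate for every `s
< 1` (`exists_J_add_J_le`, `integral_formIntegrand_le_of_symm`). The pointwise comparison is
`formIntegrand_le`.

Let `L` be the average of order `q - 1` of `u` over the annulus and take `ℓ = σ L`. Jensen gives `L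
^ (p - 1) ≤ ⨍ u ^ (p - 1)`, so for small `σ` both brackets are negative at this one height. If `∫ η
> 0`, dividing by it and dropping the `q` term leaves `L ^ (p - 1) ≤ (2 / c) K R ^ (s p)`, and the
claimed lower bound is not positive. Otherwise `η = 0` almost everywhere, so `u ≥ σ L` on `B_{R/4}`.

The function `η` is not smooth, so it must first be admitted as a test function. The form tested
with a mollification of `η` is an average of forms tested with translates of `η`
(`weakForm_mollify`), and the latter are continuous in the translation at the origin
(`formIntegrand_properties`). No convergence of mollifications in a Sobolev space is needed. -/

lemma J_neg (m t : ℝ) : J m (-t) = -J m t := by simp [J]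

lemma J_sub_comm (m a b : ℝ) : J m (a - b) = -J m (b - a) := by
  rw [← J_neg, neg_sub]

lemma J_zero (m : ℝ) : J m 0 = 0 := by simp [J]

lemma J_of_nonneg {m t : ℝ} (hm : 2 ≤ m) (ht : 0 ≤ t) : J m t = t ^ (m - 1) := by
  rcases ht.eq_or_lt with rfl | h
  · rw [J_zero, Real.zero_rpow (by linarith)]
  · rw [J, abs_of_pos h]
    nth_rewrite 2 [← Real.rpow_one t]
    rw [← Real.rpow_add h]; congr 1; ring

lemma J_of_nonpos {m t : ℝ} (hm : 2 ≤ m) (ht : t ≤ 0) : J m t = -(-t) ^ (m - 1) := by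
  rw [← J_of_nonneg hm (neg_nonneg.2 ht), J_neg, neg_neg]

lemma abs_J {m : ℝ} (hm : 2 ≤ m) (t : ℝ) : |J m t| = |t| ^ (m - 1) := by
  rcases le_total 0 t with h | h
  · rw [J_of_nonneg hm h, abs_of_nonneg h, abs_of_nonneg (Real.rpow_nonneg h _)]
  · rw [J_of_nonpos hm h, abs_neg, abs_of_nonpos h,
      abs_of_nonneg (Real.rpow_nonneg (neg_nonneg.2 h) _)]

lemma J_nonneg {m t : ℝ} (ht : 0 ≤ t) : 0 ≤ J m t :=
  mul_nonneg (Real.rpow_nonneg (abs_nonneg _) _) ht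

lemma J_nonpos {m t : ℝ} (ht : t ≤ 0) : J m t ≤ 0 :=
  mul_nonpos_of_nonneg_of_nonpos (Real.rpow_nonneg (abs_nonneg _) _) ht

lemma J_mono {m : ℝ} (hm : 2 ≤ m) : Monotone (J m) := by
  intro a b hab
  rcases le_total 0 a with ha | ha
  · rw [J_of_nonneg hm ha, J_of_nonneg hm (ha.trans hab)]
    exact Real.rpow_le_rpow ha hab (by linarith)
  · rcases le_total 0 b with hb | hb
    · exact (J_nonpos ha).trans (J_nonneg hb)
    · rw [J_of_nonpos hm ha, J_of_nonpos hm hb]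
      exact neg_le_neg (Real.rpow_le_rpow (by linarith) (by linarith) (by linarith))

lemma continuous_J {m : ℝ} (hm : 2 ≤ m) : Continuous (J m) :=
  (continuous_abs.rpow_const fun _ => Or.inr (by linarith)).mul continuous_id

lemma J_mul (m : ℝ) {l : ℝ} (hl : 0 < l) (t : ℝ) : J m (l * t) = l ^ (m - 1) * J m t := by
  rw [J, J, abs_mul, abs_of_pos hl, Real.mul_rpow hl.le (abs_nonneg t),
    show m - 1 = (m - 2) + 1 by ring, Real.rpow_add hl, Real.rpow_one]
  ring

/-- Lipschitz estimate for the power `t ^ (m - 1)` on `[0, M]`. -/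
lemma rpow_sub_rpow_le {m M a b : ℝ} (hm : 2 ≤ m) (hb : 0 ≤ b) (hab : b ≤ a) (haM : a ≤ M) :
    a ^ (m - 1) - b ^ (m - 1) ≤ (m - 1) * M ^ (m - 2) * (a - b) := by
  have hd : ∀ x ∈ Set.Icc 0 M,
      HasDerivWithinAt (fun x : ℝ => x ^ (m - 1)) ((m - 1) * x ^ (m - 1 - 1)) (Set.Icc 0 M) x :=
    fun x _ => (Real.hasDerivAt_rpow_const (Or.inr (by linarith))).hasDerivWithinAt
  have hC : ∀ x ∈ Set.Icc 0 M, ‖(m - 1) * x ^ (m - 1 - 1)‖ ≤ (m - 1) * M ^ (m - 2) := by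
    intro x hx
    rw [Real.norm_of_nonneg (mul_nonneg (by linarith) (Real.rpow_nonneg hx.1 _))]
    refine mul_le_mul_of_nonneg_left ?_ (by linarith)
    rw [show m - 1 - 1 = m - 2 by ring]
    exact Real.rpow_le_rpow hx.1 hx.2 (by linarith)
  have := (convex_Icc 0 M).norm_image_sub_le_of_norm_hasDerivWithin_le hd hC
    (show b ∈ Set.Icc 0 M from ⟨hb, hab.trans haM⟩) (show a ∈ Set.Icc 0 M from ⟨hb.trans hab, haM⟩)
  rw [Real.norm_eq_abs, Real.norm_eq_abs, abs_of_nonneg (sub_nonneg.2 hab)] at this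
  exact (le_abs_self _).trans this

lemma J_sub_J_le {m M a b : ℝ} (hm : 2 ≤ m) (hab : b ≤ a) (ha : |a| ≤ M) (hb : |b| ≤ M) :
    J m a - J m b ≤ (m - 1) * M ^ (m - 2) * (a - b) := by
  rw [abs_le] at ha hb
  rcases le_total 0 b with h | h
  · rw [J_of_nonneg hm h, J_of_nonneg hm (h.trans hab)]
    exact rpow_sub_rpow_le hm h hab ha.2
  · rcases le_total 0 a with h' | h'
    · rw [J_of_nonneg hm h', J_of_nonpos hm h]
      have h1 := rpow_sub_rpow_le hm le_rfl h' ha.2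
      have h2 := rpow_sub_rpow_le hm le_rfl (neg_nonneg.2 h) (show -b ≤ M by linarith)
      rw [Real.zero_rpow (by linarith)] at h1 h2
      calc _ = (a ^ (m - 1) - 0) + ((-b) ^ (m - 1) - 0) := by ring
        _ ≤ _ := add_le_add h1 h2
        _ = _ := by ring
    · rw [J_of_nonpos hm h, J_of_nonpos hm h']
      have := rpow_sub_rpow_le hm (neg_nonneg.2 h') (neg_le_neg hab) (show -b ≤ M by linarith)
      calc _ = (-b) ^ (m - 1) - (-a) ^ (m - 1) := by ring
        _ ≤ _ := this
        _ = _ := by ring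

lemma abs_J_sub_J_le {m M a b : ℝ} (hm : 2 ≤ m) (ha : |a| ≤ M) (hb : |b| ≤ M) :
    |J m a - J m b| ≤ (m - 1) * M ^ (m - 2) * |a - b| := by
  rcases le_total b a with h | h
  · rw [abs_of_nonneg (sub_nonneg.2 (J_mono hm h)), abs_of_nonneg (sub_nonneg.2 h)]
    exact J_sub_J_le hm h ha hb
  · rw [abs_sub_comm, abs_sub_comm a, abs_of_nonneg (sub_nonneg.2 (J_mono hm h)),
      abs_of_nonneg (sub_nonneg.2 h)]
    exact J_sub_J_le hm h hb ha

/-- If `b ≥ 2 * a`, then `b - a ≥ b / 2` and the negative term alone suffices. Otherwise `(b / 2) ^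
(m - 1) ≤ a ^ (m - 1)`, and the second copy of `a ^ (m - 1)` absorbs it. -/
lemma J_sub_le {m a b : ℝ} (hm : 2 ≤ m) (ha : 0 ≤ a) (hb : 0 ≤ b) :
    J m (a - b) ≤ 2 * a ^ (m - 1) - 2 ^ (1 - m) * b ^ (m - 1) := by
  have key : ∀ t : ℝ, 0 ≤ t → (t / 2) ^ (m - 1) = 2 ^ (1 - m) * t ^ (m - 1) := by
    intro t ht
    rw [Real.div_rpow ht (by norm_num), show (1 - m) = -(m - 1) by ring,
      Real.rpow_neg (by norm_num)]
    field_simp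
  have hap := Real.rpow_nonneg ha (m - 1)
  rw [← key b hb]
  rcases le_total (2 * a) b with h | h
  · rw [J_of_nonpos hm (by linarith)]
    have := Real.rpow_le_rpow (by linarith) (show b / 2 ≤ -(a - b) by linarith)
      (show 0 ≤ m - 1 by linarith)
    linarith
  · have h1 : J m (a - b) ≤ a ^ (m - 1) := by
      rw [← J_of_nonneg hm ha]; exact J_mono hm (by linarith)
    have := Real.rpow_le_rpow (by linarith) (show b / 2 ≤ a by linarith)
      (show 0 ≤ m - 1 by linarith)
    linarith

/-- Monotonicity of `J` tested with the positive part of a difference. -/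
lemma J_mul_posPart_le {m : ℝ} (hm : 2 ≤ m) (a b v w : ℝ) :
    J m (a - b) * (max (v - a) 0 - max (w - b) 0) ≤
      J m (v - w) * (max (v - a) 0 - max (w - b) 0) := by
  rcases lt_trichotomy (max (w - b) 0) (max (v - a) 0) with h | h | h
  · refine mul_le_mul_of_nonneg_right (J_mono hm ?_) (sub_nonneg.2 h.le)
    have h0 : 0 < max (v - a) 0 := (le_max_right _ _).trans_lt h
    have h1 : 0 < v - a := by simpa using h0
    rw [max_eq_left h1.le] at h
    linarith [le_max_left (w - b) 0]
  · rw [h]; simp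
  · refine mul_le_mul_of_nonpos_right (J_mono hm ?_) (sub_nonpos.2 h.le)
    have h0 : 0 < max (w - b) 0 := (le_max_right _ _).trans_lt h
    have h1 : 0 < w - b := by simpa using h0
    rw [max_eq_left h1.le] at h
    linarith [le_max_left (v - a) 0]

/-- The gain obtained from a point `b` at which the barrier vanishes. -/
lemma J_mul_posPart_le_of_nonneg {m : ℝ} (hm : 2 ≤ m) {a b v : ℝ} (hb : 0 ≤ b)
    (hv : 0 ≤ v) :
    J m (a - b) * max (v - a) 0 ≤
      (2 * v ^ (m - 1) - 2 ^ (1 - m) * b ^ (m - 1)) * max (v - a) 0 := by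
  rcases le_total (v - a) 0 with h | h
  · simp [max_eq_right h]
  · rw [max_eq_left h]
    exact mul_le_mul_of_nonneg_right
      ((J_mono hm (by linarith)).trans (J_sub_le hm hv hb)) h

/-! ### The singular kernel -/

/-- The kernel `‖x‖ ^ (-κ)`. -/
noncomputable def ker {N : ℕ} (κ : ℝ) (x : Space N) : ℝ := (‖x‖ ^ κ)⁻¹

section Kernel

variable {N : ℕ} {κ m : ℝ}

lemma ker_nonneg (κ : ℝ) (x : Space N) : 0 ≤ ker κ x := by unfold ker; positivity

lemma ker_neg (κ : ℝ) (x : Space N) : ker κ (-x) = ker κ x := by simp [ker]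

lemma ker_sub_comm (κ : ℝ) (x y : Space N) : ker κ (x - y) = ker κ (y - x) := by
  rw [← ker_neg, neg_sub]

lemma measurable_ker (κ : ℝ) : Measurable (ker κ : Space N → ℝ) := by
  unfold ker; fun_prop

lemma ker_le_ker (hκ : 0 ≤ κ) {x : Space N} {r : ℝ} (hr : 0 < r) (h : r ≤ ‖x‖) :
    ker κ x ≤ (r ^ κ)⁻¹ :=
  inv_anti₀ (Real.rpow_pos_of_pos hr _) (Real.rpow_le_rpow hr.le h hκ)

lemma le_ker (hκ : 0 ≤ κ) {x : Space N} {r : ℝ} (hx : 0 < ‖x‖) (h : ‖x‖ ≤ r) :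
    (r ^ κ)⁻¹ ≤ ker κ x :=
  inv_anti₀ (Real.rpow_pos_of_pos hx _) (Real.rpow_le_rpow hx.le h hκ)

lemma ker_smul (κ : ℝ) {R : ℝ} (hR : 0 < R) (x : Space N) :
    ker κ (R⁻¹ • x) = R ^ κ * ker κ x := by
  unfold ker
  rw [norm_smul, norm_inv, Real.norm_of_nonneg hR.le, Real.mul_rpow (by positivity)
    (norm_nonneg _), Real.inv_rpow hR.le, mul_inv, inv_inv]

/-- The truncated kernel `min (‖x‖ ^ m) 1 * ‖x‖ ^ (-κ)`. -/
noncomputable def truncKer {N : ℕ} (m κ : ℝ) (x : Space N) : ℝ := min (‖x‖ ^ m) 1 * ker κ x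

lemma truncKer_nonneg (m κ : ℝ) (x : Space N) : 0 ≤ truncKer m κ x :=
  mul_nonneg (le_min (by positivity) zero_le_one) (ker_nonneg _ _)

lemma measurable_truncKer (m κ : ℝ) : Measurable (truncKer m κ : Space N → ℝ) := by
  have := measurable_ker (N := N) κ
  unfold truncKer; fun_prop

lemma integrable_one_add_norm_rpow_inv (hκ : (N : ℝ) < κ) :
    Integrable (fun x : Space N => ((1 + ‖x‖) ^ κ)⁻¹) := by
  have := integrable_one_add_norm (E := Space N) (μ := volume) (r := κ) (by simpa using hκ)
  refine this.congr (.of_forall fun x => ?_)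
  exact Real.rpow_neg (by positivity) _

/-- Near the origin the function is of size `‖x‖ ^ (m - κ)`, at infinity `‖x‖ ^ (-κ)`. For `κ = N +
s * m` the two hypotheses on `κ` amount to `s > 0` and `s < 1`. -/
lemma integrable_truncKer (hN : 1 ≤ N) (hκ : (N : ℝ) < κ) (hm : κ - m < N) :
    Integrable (truncKer m κ : Space N → ℝ) := by
  rw [← integrableOn_univ, ← Set.union_compl_self (Metric.ball (0 : Space N) 1)]
  have hκ0 : 0 ≤ κ := (Nat.cast_nonneg N).trans hκ.le
  refine IntegrableOn.union ?_ ?_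
  · refine integrableOn_ball_of_norm_le_rpow (C := 1) (α := κ - m) (by simpa using hN)
      (by simpa using hm) ?_ (measurable_truncKer _ _).aestronglyMeasurable
    refine ae_restrict_of_ae (.of_forall fun x => ?_)
    rw [Real.norm_of_nonneg (truncKer_nonneg _ _ _), one_mul]
    rcases (norm_nonneg x).eq_or_lt with h | h
    · have hx : truncKer m κ x = 0 := by
        unfold truncKer ker
        rw [← h, Real.zero_rpow (x := κ), inv_zero, mul_zero]
        have : (1 : ℝ) ≤ N := by exact_mod_cast hN
        linarith
      rw [hx]; positivity
    · calc truncKer m κ x ≤ ‖x‖ ^ m * ker κ x :=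
          mul_le_mul_of_nonneg_right (min_le_left _ _) (ker_nonneg _ _)
        _ = ‖x‖ ^ (-(κ - m)) := by
          rw [ker, ← Real.rpow_neg h.le, ← Real.rpow_add h]; congr 1; ring
  · refine Integrable.mono' (((integrable_one_add_norm_rpow_inv hκ).const_mul
      (2 ^ κ)).integrableOn) (measurable_truncKer _ _).aestronglyMeasurable ?_
    filter_upwards [ae_restrict_mem Metric.isOpen_ball.measurableSet.compl] with x hx
    rw [Real.norm_of_nonneg (truncKer_nonneg _ _ _)]
    have hx1 : 1 ≤ ‖x‖ := by simpa using hx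
    calc truncKer m κ x ≤ 1 * ker κ x :=
          mul_le_mul_of_nonneg_right (min_le_right _ _) (ker_nonneg _ _)
      _ ≤ 1 * (((1 + ‖x‖) / 2) ^ κ)⁻¹ := by
          gcongr
          exact ker_le_ker hκ0 (by positivity) (by linarith)
      _ = _ := by
          rw [Real.div_rpow (by positivity) (by norm_num), inv_div, one_mul, div_eq_mul_inv]

lemma min_smul_mul_ker {R : ℝ} (hR : 0 < R) (x : Space N) :
    min (‖R⁻¹ • x‖ ^ m) 1 * ker κ x = (R ^ κ)⁻¹ * truncKer m κ (R⁻¹ • x) := by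
  rw [truncKer, ker_smul κ hR]
  have := (Real.rpow_pos_of_pos hR κ).ne'
  field_simp

lemma integrable_min_smul_mul_ker (hN : 1 ≤ N) (hκ : (N : ℝ) < κ) (hm : κ - m < N) {R : ℝ}
    (hR : 0 < R) : Integrable (fun x : Space N => min (‖R⁻¹ • x‖ ^ m) 1 * ker κ x) := by
  simp_rw [min_smul_mul_ker hR]
  exact ((integrable_truncKer hN hκ hm).comp_smul (inv_ne_zero hR.ne')).const_mul _

lemma integral_min_smul_mul_ker {R : ℝ} (hR : 0 < R) :
    ∫ x : Space N, min (‖R⁻¹ • x‖ ^ m) 1 * ker κ x =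
      (R ^ (κ - N))⁻¹ * ∫ x : Space N, truncKer m κ x := by
  simp_rw [min_smul_mul_ker hR]
  rw [integral_const_mul, Measure.integral_comp_inv_smul_of_nonneg _ _ hR.le, smul_eq_mul,
    ← mul_assoc, Real.rpow_sub hR, Real.rpow_natCast, finrank_euclideanSpace_fin, inv_div]
  congr 1; rw [div_eq_mul_inv, mul_comm]

/-! ### Smooth compactly supported functions -/

lemma abs_sub_rpow_le_min {φ : Space N → ℝ} {K : NNReal} {M : ℝ} (hm : 0 ≤ m)
    (hK : LipschitzWith K φ) (hM : ∀ x, |φ x| ≤ M) (x y : Space N) :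
    |φ x - φ y| ^ m ≤ ((K : ℝ) ^ m + (2 * M) ^ m) * min (‖x - y‖ ^ m) 1 := by
  have hM0 : 0 ≤ M := (abs_nonneg _).trans (hM 0)
  have h1 : |φ x - φ y| ^ m ≤ (K : ℝ) ^ m * ‖x - y‖ ^ m := by
    rw [← Real.mul_rpow K.coe_nonneg (norm_nonneg _)]
    refine Real.rpow_le_rpow (abs_nonneg _) ?_ hm
    simpa using hK.norm_sub_le x y
  have h2 : |φ x - φ y| ^ m ≤ (2 * M) ^ m := by
    refine Real.rpow_le_rpow (abs_nonneg _) ?_ hm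
    calc |φ x - φ y| ≤ |φ x| + |φ y| := abs_sub _ _
      _ ≤ 2 * M := by linarith [hM x, hM y]
  have hA : 0 ≤ (K : ℝ) ^ m := Real.rpow_nonneg K.coe_nonneg _
  have hB : 0 ≤ (2 * M) ^ m := by positivity
  rcases min_cases (‖x - y‖ ^ m) 1 with ⟨h, -⟩ | ⟨h, -⟩ <;> rw [h]
  · nlinarith [Real.rpow_nonneg (norm_nonneg (x - y)) m]
  · linarith

/-- The increment `y ↦ φ (y + h) - φ y` has derivative of norm at most `C * ‖h‖`, because `fderiv ℝ
φ` is Lipschitz; the second difference is the change of this increment over a step `h`. -/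
lemma exists_second_difference_le {φ : Space N → ℝ} (hφ : ContDiff ℝ ∞ φ)
    (hc : HasCompactSupport φ) :
    ∃ C : ℝ, 0 ≤ C ∧ ∀ x h, |φ (x + h) + φ (x - h) - 2 * φ x| ≤ C * ‖h‖ ^ 2 := by
  obtain ⟨C, hC⟩ := ContDiff.lipschitzWith_of_hasCompactSupport (𝕂 := ℝ) (n := ∞)
    (hc.fderiv ℝ) (hφ.fderiv_right (m := ∞) (by simp)) (by simp)
  refine ⟨C, C.2, fun x h => ?_⟩
  have hd : Differentiable ℝ φ := hφ.differentiable (by simp)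
  have hL := Convex.norm_image_sub_le_of_norm_hasFDerivWithin_le (𝕜 := ℝ) (s := Set.univ)
    (f := fun y => φ (y + h) - φ y) (f' := fun y => fderiv ℝ φ (y + h) - fderiv ℝ φ y)
    (C := C * ‖h‖) (x := x - h) (y := x)
    (fun y _ => by
      refine HasFDerivAt.hasFDerivWithinAt ?_
      exact ((hasFDerivAt_comp_add_right h).2 (hd (y + h)).hasFDerivAt).sub (hd y).hasFDerivAt)
    (fun y _ => by simpa using hC.norm_sub_le (y + h) y)
    convex_univ (Set.mem_univ _) (Set.mem_univ _)
  have e : φ (x + h) + φ (x - h) - 2 * φ x =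
      (φ (x + h) - φ x) - (φ (x - h + h) - φ (x - h)) := by
    rw [sub_add_cancel]; ring
  rw [e, ← Real.norm_eq_abs]
  refine hL.trans (le_of_eq ?_)
  rw [sub_sub_cancel]; ring

/-- The symmetrized increments of a test function are of order `‖h‖ ^ m`. -/
lemma exists_J_add_J_le (hm : 2 ≤ m) {φ : Space N → ℝ} (hφ : ContDiff ℝ ∞ φ)
    (hc : HasCompactSupport φ) :
    ∃ C : ℝ, 0 ≤ C ∧ ∀ x h,
      |J m (φ x - φ (x + h)) + J m (φ x - φ (x - h))| ≤ C * min (‖h‖ ^ m) 1 := by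
  obtain ⟨C₂, hC₂, h2⟩ := exists_second_difference_le hφ hc
  obtain ⟨K, hK⟩ := ContDiff.lipschitzWith_of_hasCompactSupport (𝕂 := ℝ) (n := ∞) hc hφ (by simp)
  obtain ⟨M, hM⟩ := hc.exists_bound_of_continuous hφ.continuous
  have hM0 : 0 ≤ M := (norm_nonneg _).trans (hM 0)
  set A := (m - 1) * (K : ℝ) ^ (m - 2) * C₂ with hA
  set B := 2 * (2 * M) ^ (m - 1) with hB
  have hA0 : 0 ≤ A := by
    have : 0 ≤ m - 1 := by linarith
    have := Real.rpow_nonneg K.coe_nonneg (m - 2)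
    positivity
  have hB0 : 0 ≤ B := by positivity
  refine ⟨A + B, by positivity, fun x h => ?_⟩
  have hr : 0 ≤ ‖h‖ ^ m := by positivity
  have hlarge : |J m (φ x - φ (x + h)) + J m (φ x - φ (x - h))| ≤ B := by
    have : ∀ y, |J m (φ x - φ y)| ≤ (2 * M) ^ (m - 1) := fun y => by
      rw [abs_J hm]
      refine Real.rpow_le_rpow (abs_nonneg _) ?_ (by linarith)
      have hx := hM x
      have hy := hM y
      rw [Real.norm_eq_abs] at hx hy
      linarith [abs_sub (φ x) (φ y)]
    linarith [abs_add_le (J m (φ x - φ (x + h))) (J m (φ x - φ (x - h))), this (x + h),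
      this (x - h)]
  have hsmall : |J m (φ x - φ (x + h)) + J m (φ x - φ (x - h))| ≤ A * ‖h‖ ^ m := by
    rcases (norm_nonneg h).eq_or_lt with h0 | h0
    · have : h = 0 := norm_eq_zero.1 h0.symm
      simp only [this, add_zero, sub_self, J_zero, sub_zero, abs_zero]
      positivity
    have hb : ∀ y, ‖x - y‖ = ‖h‖ → |φ x - φ y| ≤ K * ‖h‖ := fun y hy => by
      rw [← hy]; exact hK.norm_sub_le x y
    -- As `J` is odd, the sum is a difference of `J` at two points of size at most `K * ‖h‖` whose
    -- distance is a second difference. The Lipschitz factor `‖h‖ ^ (m - 2)` times `‖h‖ ^ 2` gives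
    -- `‖h‖ ^ m`. A single `J` is only of order `‖h‖ ^ (m - 1)`, too weak when `s` is close to one.
    have h3 := abs_J_sub_J_le hm (M := K * ‖h‖) (a := φ x - φ (x + h)) (b := -(φ x - φ (x - h)))
      (hb _ (by simp)) (by rw [abs_neg]; exact hb _ (by simp))
    rw [J_neg, sub_neg_eq_add] at h3
    refine h3.trans ?_
    have h4 : |φ x - φ (x + h) - -(φ x - φ (x - h))| ≤ C₂ * ‖h‖ ^ 2 := by
      have := h2 x h
      rw [← abs_neg] at this
      convert this using 2; ring
    have hp : ‖h‖ ^ (m - 2) * ‖h‖ ^ 2 = ‖h‖ ^ m := by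
      rw [← Real.rpow_natCast, ← Real.rpow_add h0]; norm_num
    calc _ ≤ (m - 1) * (K * ‖h‖) ^ (m - 2) * (C₂ * ‖h‖ ^ 2) :=
          mul_le_mul_of_nonneg_left h4 (mul_nonneg (by linarith)
            (Real.rpow_nonneg (mul_nonneg K.coe_nonneg h0.le) _))
      _ = A * (‖h‖ ^ (m - 2) * ‖h‖ ^ 2) := by
          rw [Real.mul_rpow K.coe_nonneg h0.le, hA]; ring
      _ = _ := by rw [hp]
  rcases min_cases (‖h‖ ^ m) 1 with ⟨h, -⟩ | ⟨h, -⟩ <;> rw [h]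
  · nlinarith
  · linarith

end Kernel

/-! ### Pairings with a translated function -/

lemma integral_norm_mul_le_eLpNorm {p q : ENNReal} [p.HolderConjugate q] 
    {X : Type*} [MeasurableSpace X] {μ : Measure X} {f g : X → ℝ}
    (hf : MemLp f p μ) (hg : MemLp g q μ) :
    ∫ z, ‖f z * g z‖ ∂μ ≤ (eLpNorm f p μ).toReal * (eLpNorm g q μ).toReal := by
  have h := eLpNorm_smul_le_mul_eLpNorm (p := p) (q := q) (r := 1) hg.1 hf.1
  have hint : Integrable (f • g) μ := memLp_one_iff_integrable.1 (hg.smul hf)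
  have e : ∫ z, ‖f z * g z‖ ∂μ = (eLpNorm (f • g) 1 μ).toReal := by
    rw [eLpNorm_one_eq_lintegral_enorm, ← integral_norm_eq_lintegral_enorm hint.1]
    rfl
  rw [e, ← ENNReal.toReal_mul]
  exact ENNReal.toReal_mono (ENNReal.mul_ne_top hf.2.ne hg.2.ne) h

section Shift

variable {E : Type*} [NormedAddCommGroup E] [MeasurableSpace E] [BorelSpace E]
  {μ : Measure E} [μ.IsAddRightInvariant]

lemma measurePreserving_sub_const (a : E) : MeasurePreserving (fun z => z - a) μ μ :=
  MeasureTheory.measurePreserving_sub_right μ a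

lemma tendsto_eLpNorm_translate_sub [IsLocallyFiniteMeasure μ] [μ.InnerRegularCompactLTTop]
    {r : ENNReal} (hr1 : 1 ≤ r) (hr : r ≠ ⊤) {G : E → ℝ} (hG : MemLp G r μ) :
    Tendsto (fun a : E => eLpNorm (fun z => G (z - a) - G z) r μ) (𝓝 0) (𝓝 0) := by
  have : Fact (1 ≤ r) := ⟨hr1⟩
  let g : E → C(E, E) := fun a => ⟨fun z => z - a, by fun_prop⟩
  have hg : Continuous g :=
    (ContinuousMap.mk (fun p : E × E => p.2 - p.1) (by fun_prop)).curry.continuous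
  have h := (continuous_const (y := hG.toLp G)).compMeasurePreservingLp hg
    (fun a => measurePreserving_sub_const (μ := μ) a) hr
  have h' := (h.tendsto 0).edist (tendsto_const_nhds (x := hG.toLp G))
  have e0 : Lp.compMeasurePreserving (g 0) (measurePreserving_sub_const (μ := μ) 0)
      (hG.toLp G) = hG.toLp G := by
    rw [Lp.toLp_compMeasurePreserving hG]
    congr 1; ext z; simp [g]
  rw [e0, edist_self] at h'
  refine h'.congr fun a => ?_
  rw [Lp.toLp_compMeasurePreserving hG, Lp.edist_toLp_toLp]
  rfl

/-- `a ↦ ∫ Φ(z) Ψ(z - a) dz` is well defined, bounded, and continuous at the origin. -/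
structure ShiftPair (μ : Measure E) (Φ Ψ : E → ℝ) : Prop where
  integrable : ∀ a, Integrable (fun z => Φ z * Ψ (z - a)) μ
  bound : ∃ M, ∀ a, ∫ z, ‖Φ z * Ψ (z - a)‖ ∂μ ≤ M
  tendsto : Tendsto (fun a => ∫ z, Φ z * Ψ (z - a) ∂μ) (𝓝 0) (𝓝 (∫ z, Φ z * Ψ z ∂μ))

lemma ShiftPair.of_memLp [IsLocallyFiniteMeasure μ] [μ.InnerRegularCompactLTTop]
    {p q : ENNReal} [p.HolderConjugate q] (hq1 : 1 ≤ q) (hq : q ≠ ⊤) {Φ Ψ : E → ℝ}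
    (hΦ : MemLp Φ p μ) (hΨ : MemLp Ψ q μ) : ShiftPair μ Φ Ψ := by
  have hT : ∀ a, MemLp (fun z => Ψ (z - a)) q μ := fun a =>
    hΨ.comp_measurePreserving (measurePreserving_sub_const a)
  have hI : ∀ a, Integrable (fun z => Φ z * Ψ (z - a)) μ := fun a => hΦ.integrable_mul (hT a)
  refine ⟨hI, ⟨(eLpNorm Φ p μ).toReal * (eLpNorm Ψ q μ).toReal, fun a => ?_⟩, ?_⟩
  · have h := integral_norm_mul_le_eLpNorm hΦ (hT a)
    have e : eLpNorm (fun z => Ψ (z - a)) q μ = eLpNorm Ψ q μ :=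
      eLpNorm_comp_measurePreserving hΨ.1 (measurePreserving_sub_const a)
    rwa [e] at h
  · have hlim := (ENNReal.tendsto_toReal ENNReal.zero_ne_top).comp
      (tendsto_eLpNorm_translate_sub hq1 hq hΨ)
    have hlim' := hlim.const_mul (eLpNorm Φ p μ).toReal
    rw [ENNReal.toReal_zero, mul_zero] at hlim'
    rw [tendsto_iff_norm_sub_tendsto_zero]
    refine squeeze_zero (fun _ => norm_nonneg _) (fun a => ?_) hlim'
    have hI0 : Integrable (fun z => Φ z * Ψ z) μ := hΦ.integrable_mul hΨ
    rw [← integral_sub (hI a) hI0]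
    refine (norm_integral_le_integral_norm _).trans ?_
    have h := integral_norm_mul_le_eLpNorm hΦ ((hT a).sub hΨ)
    refine le_trans (le_of_eq ?_) h
    refine integral_congr_ae (.of_forall fun z => ?_)
    simp [mul_sub]

lemma ShiftPair.swap {Φ Ψ : E → ℝ} (h : ShiftPair μ Φ Ψ) : ShiftPair μ Ψ Φ := by
  have e : ∀ a, (fun z => Ψ z * Φ (z - a)) = (fun z => Φ z * Ψ (z - -a)) ∘ (fun z => z - a) := by
    intro a; ext z; simp [mul_comm]
  refine ⟨fun a => ?_, ?_, ?_⟩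
  · rw [e a]
    exact (measurePreserving_sub_const a).integrable_comp_of_integrable (h.integrable (-a))
  · obtain ⟨M, hM⟩ := h.bound
    refine ⟨M, fun a => le_trans (le_of_eq ?_) (hM (-a))⟩
    rw [← integral_sub_right_eq_self (fun z => ‖Φ z * Ψ (z - -a)‖) a]
    exact integral_congr_ae (.of_forall fun z => congrArg norm (congrFun (e a) z))
  · have ht := h.tendsto.comp (show Tendsto (fun a : E => -a) (𝓝 0) (𝓝 0) by
      simpa using (continuous_neg (G := E)).tendsto 0)
    simp_rw [mul_comm (Ψ _) (Φ _)] at *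
    refine ht.congr fun a => ?_
    rw [Function.comp_apply, ← integral_sub_right_eq_self _ a]
    refine integral_congr_ae (.of_forall fun z => ?_)
    simp

/-- Translation is continuous in `L¹` but not in `L^∞`, so the translation is moved onto the
integrable factor by `swap`. -/
lemma ShiftPair.of_integrable_of_bound [IsLocallyFiniteMeasure μ] [μ.InnerRegularCompactLTTop]
    {Φ Ψ : E → ℝ} (hΦ : Integrable Φ μ) (hΨ : AEStronglyMeasurable Ψ μ) {C : ℝ}
    (hC : ∀ z, ‖Ψ z‖ ≤ C) : ShiftPair μ Φ Ψ :=
  (ShiftPair.of_memLp (p := ⊤) (q := 1) le_rfl ENNReal.one_ne_top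
    (memLp_top_of_bound hΨ C (.of_forall hC)) (memLp_one_iff_integrable.2 hΦ)).swap

end Shift

/-- Averaging an integral against a weight supported where the integrals are bounded. -/
lemma integral_weighted_swap {E X : Type*} [NormedAddCommGroup E] [MeasurableSpace E]
    [OpensMeasurableSpace E]
    [MeasurableSpace X] {ν : Measure E} {μ : Measure X} [SFinite ν] [SFinite μ] {ρ : E → ℝ}
    (hρ : Integrable ρ ν) {δ : ℝ} (hsupp : ∀ h, δ < ‖h‖ → ρ h = 0) {H : E × X → ℝ}
    (hρm : Measurable ρ) (hH : Measurable H)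
    (hint : ∀ h, ‖h‖ ≤ δ → Integrable (fun z => H (h, z)) μ) {M : ℝ}
    (hM : ∀ h, ‖h‖ ≤ δ → ∫ z, ‖H (h, z)‖ ∂μ ≤ M) :
    Integrable (fun h => ρ h * ∫ z, H (h, z) ∂μ) ν ∧
      ∫ z, ∫ h, ρ h * H (h, z) ∂ν ∂μ = ∫ h, ρ h * ∫ z, H (h, z) ∂μ ∂ν := by
  have hmeas : AEStronglyMeasurable (fun w : E × X => ρ w.1 * H w) (ν.prod μ) :=
    ((hρm.comp measurable_fst).mul hH).aestronglyMeasurable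
  have hI : Integrable (fun w : E × X => ρ w.1 * H w) (ν.prod μ) := by
    rw [integrable_prod_iff hmeas]
    refine ⟨.of_forall fun h => ?_, ?_⟩
    · by_cases hh : ‖h‖ ≤ δ
      · exact (hint h hh).const_mul (ρ h)
      · simp [hsupp h (not_le.1 hh)]
    · refine (hρ.norm.mul_const M).mono' hmeas.norm.integral_prod_right' (.of_forall fun h => ?_)
      rw [Real.norm_of_nonneg (integral_nonneg fun _ => norm_nonneg _)]
      by_cases hh : ‖h‖ ≤ δ
      · simp_rw [norm_mul]
        rw [integral_const_mul]
        refine mul_le_mul_of_nonneg_left ?_ (norm_nonneg _)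
        simpa using hM h hh
      · simp [hsupp h (not_le.1 hh)]
  refine ⟨hI.integral_prod_left.congr
    (.of_forall fun h => integral_const_mul (ρ h) fun z => H (h, z)), ?_⟩
  rw [← integral_integral_swap (f := fun h z => ρ h * H (h, z)) hI]
  simp_rw [integral_const_mul]

/-! ### The nonlocal form tested with translates -/

section Form

variable {N : ℕ} {κ m r₀ r ρ : ℝ} {u η : Space N → ℝ}

/-- The integrand of the nonlocal form of `u` tested with the translate of `η` by `h`. -/
noncomputable def formIntegrand (m κ : ℝ) (u η : Space N → ℝ) (h : Space N)
    (z : Space N × Space N) : ℝ :=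
  J m (u z.1 - u z.2) * (η (z.1 - h) - η (z.2 - h)) * ker κ (z.1 - z.2)

/-- Integrability properties of `u` that make the nonlocal form finite. -/
structure Admissible (m κ r ρ : ℝ) (u : Space N → ℝ) : Prop where
  measurable : Measurable u
  near : IntegrableOn (fun z : Space N × Space N => |u z.1 - u z.2| ^ m * ker κ (z.1 - z.2))
    (ball 0 ρ ×ˢ ball 0 ρ)
  far : IntegrableOn (fun z : Space N × Space N => |u z.1 - u z.2| ^ (m - 1) * ker κ (z.1 - z.2))
    (closedBall 0 r ×ˢ (ball 0 ρ)ᶜ)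

/-- Bounded functions of finite energy supported in a ball. -/
structure FiniteEnergy (m κ r₀ : ℝ) (η : Space N → ℝ) : Prop where
  measurable : Measurable η
  bounded : ∃ C, ∀ x, |η x| ≤ C
  support : ∀ x, r₀ < ‖x‖ → η x = 0
  energy : Integrable (fun z : Space N × Space N => |η z.1 - η z.2| ^ m * ker κ (z.1 - z.2))

lemma measurable_J (hm : 2 ≤ m) : Measurable (J m) := (continuous_J hm).measurable

lemma measurable_formIntegrand (hm : 2 ≤ m) (hu : Measurable u) (hη : Measurable η) :
    Measurable (fun w : Space N × (Space N × Space N) => formIntegrand m κ u η w.1 w.2) := by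
  have h1 := measurable_J hm
  have h2 := measurable_ker (N := N) κ
  unfold formIntegrand
  fun_prop

lemma measurable_diff (hu : Measurable u) :
    Measurable (fun z : Space N × Space N => u z.1 - u z.2) := by fun_prop

lemma measurable_ker_diff :
    Measurable (fun z : Space N × Space N => ker κ (z.1 - z.2)) :=
  (measurable_ker κ).comp (measurable_fst.sub measurable_snd)

/-- With `FiniteEnergy.memLp` this prepares Hölder's inequality near the diagonal: the kernel is
split as `ker ^ (1 - 1 / m) * ker ^ (1 / m)`, one factor for each of the conjugate exponents `m / (m
- 1)` and `m`. -/
lemma Admissible.memLp_near (hm : 2 ≤ m) (hu : Admissible m κ r ρ u) :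
    MemLp ((ball (0 : Space N) ρ ×ˢ ball (0 : Space N) ρ).indicator
      fun z => J m (u z.1 - u z.2) * ker κ (z.1 - z.2) ^ (1 - 1 / m))
      (ENNReal.ofReal (m / (m - 1))) volume := by
  have hp : 0 < m / (m - 1) := div_pos (by linarith) (by linarith)
  have hmeas : Measurable fun z : Space N × Space N =>
      J m (u z.1 - u z.2) * ker κ (z.1 - z.2) ^ (1 - 1 / m) :=
    ((measurable_J hm).comp (measurable_diff hu.measurable)).mul
      (measurable_ker_diff.pow_const _)
  have hs : MeasurableSet (ball (0 : Space N) ρ ×ˢ ball (0 : Space N) ρ) :=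
    measurableSet_ball.prod measurableSet_ball
  rw [memLp_indicator_iff_restrict hs,
    ← integrable_norm_rpow_iff hmeas.aestronglyMeasurable (by simpa using hp)
      ENNReal.ofReal_ne_top, ENNReal.toReal_ofReal hp.le]
  refine hu.near.congr (.of_forall fun z => ?_)
  have hk := ker_nonneg κ (z.1 - z.2)
  simp only
  rw [norm_mul, Real.norm_eq_abs, abs_J hm, Real.norm_of_nonneg (Real.rpow_nonneg hk _),
    Real.mul_rpow (by positivity) (Real.rpow_nonneg hk _), ← Real.rpow_mul (abs_nonneg _),
    ← Real.rpow_mul hk]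
  have h1 : m - 1 ≠ 0 := by linarith
  have h2 : m ≠ 0 := by linarith
  rw [show (m - 1) * (m / (m - 1)) = m by field_simp,
    show (1 - 1 / m) * (m / (m - 1)) = 1 by field_simp, Real.rpow_one]

lemma FiniteEnergy.memLp (hm : 2 ≤ m) (hη : FiniteEnergy m κ r₀ η) :
    MemLp (fun z : Space N × Space N => (η z.1 - η z.2) * ker κ (z.1 - z.2) ^ (1 / m))
      (ENNReal.ofReal m) volume := by
  have hp : 0 < m := by linarith
  have hmeas : Measurable fun z : Space N × Space N =>
      (η z.1 - η z.2) * ker κ (z.1 - z.2) ^ (1 / m) :=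
    (measurable_diff hη.measurable).mul (measurable_ker_diff.pow_const _)
  rw [← integrable_norm_rpow_iff hmeas.aestronglyMeasurable (by simpa using hp)
      ENNReal.ofReal_ne_top, ENNReal.toReal_ofReal hp.le]
  refine hη.energy.congr (.of_forall fun z => ?_)
  have hk := ker_nonneg κ (z.1 - z.2)
  simp only
  rw [norm_mul, Real.norm_eq_abs, Real.norm_of_nonneg (Real.rpow_nonneg hk _),
    Real.mul_rpow (by positivity) (Real.rpow_nonneg hk _), ← Real.rpow_mul hk,
    one_div_mul_cancel hp.ne', Real.rpow_one]

lemma Admissible.integrable_far (hm : 2 ≤ m) (hu : Admissible m κ r ρ u) :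
    Integrable ((closedBall (0 : Space N) r ×ˢ (ball (0 : Space N) ρ)ᶜ).indicator
      fun z => J m (u z.1 - u z.2) * ker κ (z.1 - z.2)) := by
  have hmeas : Measurable fun z : Space N × Space N =>
      J m (u z.1 - u z.2) * ker κ (z.1 - z.2) :=
    ((measurable_J hm).comp (measurable_diff hu.measurable)).mul measurable_ker_diff
  rw [integrable_indicator_iff (measurableSet_closedBall.prod measurableSet_ball.compl)]
  refine hu.far.mono' hmeas.aestronglyMeasurable (.of_forall fun z => ?_)
  rw [norm_mul, Real.norm_eq_abs, abs_J hm, Real.norm_of_nonneg (ker_nonneg _ _)]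

lemma Admissible.integrable_far_swap (hm : 2 ≤ m) (hu : Admissible m κ r ρ u) :
    Integrable (((ball (0 : Space N) ρ)ᶜ ×ˢ closedBall (0 : Space N) r).indicator
      fun z => J m (u z.1 - u z.2) * ker κ (z.1 - z.2)) := by
  have h := ((hu.integrable_far hm).swap).neg
  refine h.congr (.of_forall fun z => ?_)
  by_cases hz : z.1 ∈ (ball (0 : Space N) ρ)ᶜ ∧ z.2 ∈ closedBall (0 : Space N) r
  · rw [Set.indicator_of_mem (show z ∈ _ ×ˢ _ from hz)]
    simp only [Pi.neg_apply, Function.comp_apply]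
    rw [Set.indicator_of_mem (show z.swap ∈ _ ×ˢ _ from ⟨hz.2, hz.1⟩), Prod.fst_swap,
      Prod.snd_swap, J_sub_comm, ker_sub_comm]
    ring
  · rw [Set.indicator_of_notMem (show z ∉ _ ×ˢ _ from hz)]
    simp only [Pi.neg_apply, Function.comp_apply]
    rw [Set.indicator_of_notMem (fun h => hz ⟨h.2, h.1⟩), neg_zero]

/-- The form integrand splits into a part near the diagonal and two far parts. -/
lemma formIntegrand_eq (hm : 2 ≤ m) (hrρ : r < ρ) (hη : ∀ x, r₀ < ‖x‖ → η x = 0)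
    {h : Space N} (hh : ‖h‖ ≤ r - r₀) (z : Space N × Space N) :
    formIntegrand m κ u η h z =
      (ball (0 : Space N) ρ ×ˢ ball (0 : Space N) ρ).indicator
          (fun z => J m (u z.1 - u z.2) * ker κ (z.1 - z.2) ^ (1 - 1 / m)) z *
        ((η (z - (h, h)).1 - η (z - (h, h)).2) *
          ker κ ((z - (h, h)).1 - (z - (h, h)).2) ^ (1 / m)) +
      (closedBall (0 : Space N) r ×ˢ (ball (0 : Space N) ρ)ᶜ).indicator
          (fun z => J m (u z.1 - u z.2) * ker κ (z.1 - z.2)) z * η (z - (h, h)).1 -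
      ((ball (0 : Space N) ρ)ᶜ ×ˢ closedBall (0 : Space N) r).indicator
          (fun z => J m (u z.1 - u z.2) * ker κ (z.1 - z.2)) z * η (z - (h, h)).2 := by
  obtain ⟨x, y⟩ := z
  have h0 : ∀ x : Space N, r < ‖x‖ → η (x - h) = 0 := fun x hx => by
    refine hη _ ?_
    have := norm_sub_norm_le x h
    linarith
  have hk := ker_nonneg κ (x - y)
  have hm1 : 0 ≤ 1 - 1 / m := by
    rw [sub_nonneg, div_le_one (by linarith)]; linarith
  have hsplit : ker κ (x - y) ^ (1 - 1 / m) * ker κ (x - y) ^ (1 / m) = ker κ (x - y) := by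
    rw [← Real.rpow_add_of_nonneg hk hm1 (by positivity)]; simp
  simp only [formIntegrand, Set.indicator, Set.mem_prod, mem_ball_zero_iff, Set.mem_compl_iff,
    mem_closedBall_zero_iff, not_lt, Prod.fst_sub, Prod.snd_sub, sub_sub_sub_cancel_right]
  by_cases hx : ‖x‖ < ρ <;> by_cases hy : ‖y‖ < ρ
  · rw [if_pos ⟨hx, hy⟩, if_neg (show ¬(‖x‖ ≤ r ∧ ρ ≤ ‖y‖) from fun h => not_le.2 hy h.2),
      if_neg (show ¬(ρ ≤ ‖x‖ ∧ ‖y‖ ≤ r) from fun h => not_le.2 hx h.1)]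
    nth_rewrite 1 [← hsplit]
    ring
  · rw [if_neg (show ¬(‖x‖ < ρ ∧ ‖y‖ < ρ) from fun h => hy h.2),
      if_neg (show ¬(ρ ≤ ‖x‖ ∧ ‖y‖ ≤ r) from fun h => not_le.2 hx h.1)]
    rw [not_lt] at hy
    rw [h0 y (hrρ.trans_le hy)]
    by_cases hxr : ‖x‖ ≤ r
    · rw [if_pos ⟨hxr, hy⟩]; ring
    · rw [if_neg (fun h => hxr h.1), h0 x (not_le.1 hxr)]; ring
  · rw [if_neg (show ¬(‖x‖ < ρ ∧ ‖y‖ < ρ) from fun h => hx h.1),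
      if_neg (show ¬(‖x‖ ≤ r ∧ ρ ≤ ‖y‖) from fun h => not_le.2 hy h.2)]
    rw [not_lt] at hx
    rw [h0 x (hrρ.trans_le hx)]
    by_cases hyr : ‖y‖ ≤ r
    · rw [if_pos ⟨hx, hyr⟩]; ring
    · rw [if_neg (fun h => hyr h.2), h0 y (not_le.1 hyr)]; ring
  · rw [if_neg (show ¬(‖x‖ < ρ ∧ ‖y‖ < ρ) from fun h => hx h.1)]
    rw [not_lt] at hx hy
    rw [h0 x (hrρ.trans_le hx), h0 y (hrρ.trans_le hy)]
    ring

lemma integral_add_sub {X : Type*} [MeasurableSpace X] {μ : Measure X} {f g k : X → ℝ}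
    (hf : Integrable f μ) (hg : Integrable g μ) (hk : Integrable k μ) :
    ∫ z, (f z + g z - k z) ∂μ = ∫ z, f z ∂μ + ∫ z, g z ∂μ - ∫ z, k z ∂μ := by
  rw [← integral_add hf hg]
  exact integral_sub (hf.add hg) hk

lemma integral_norm_add_sub_le {X : Type*} [MeasurableSpace X] {μ : Measure X} {f g k : X → ℝ}
    (hf : Integrable f μ) (hg : Integrable g μ) (hk : Integrable k μ) :
    ∫ z, ‖f z + g z - k z‖ ∂μ ≤ ∫ z, ‖f z‖ ∂μ + ∫ z, ‖g z‖ ∂μ + ∫ z, ‖k z‖ ∂μ := by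
  rw [← integral_add hf.norm hg.norm]
  refine le_trans ?_ (integral_add (hf.norm.add hg.norm) hk.norm).le
  refine integral_mono ((hf.add hg).sub hk).norm ((hf.norm.add hg.norm).add hk.norm) fun z => ?_
  exact (norm_sub_le _ _).trans (add_le_add_left (norm_add_le _ _) _)

/-- Testing with a translate of `η` amounts to translating by the diagonal vector `(h, h)` in the
product space. The near part is an `L^{m'}`–`L^m` pairing, the far parts are `L¹`–`L^∞` pairings.
The gap `r - r₀` keeps the translated supports inside the ball of radius `r`, hence away from the
complement of the ball of radius `ρ`. -/
lemma formIntegrand_properties (hm : 2 ≤ m) (hr : r₀ < r) (hrρ : r < ρ)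
    (hu : Admissible m κ r ρ u) (hη : FiniteEnergy m κ r₀ η) :
    (∀ h, ‖h‖ ≤ r - r₀ → Integrable (formIntegrand m κ u η h)) ∧
    (∃ M, ∀ h, ‖h‖ ≤ r - r₀ → ∫ z, ‖formIntegrand m κ u η h z‖ ≤ M) ∧
    Tendsto (fun h => ∫ z, formIntegrand m κ u η h z) (𝓝 0)
      (𝓝 (∫ z, formIntegrand m κ u η 0 z)) := by
  have : (volume : Measure (Space N × Space N)).IsAddRightInvariant := by
    rw [Measure.volume_eq_prod]; infer_instance
  have hconj : (m / (m - 1)).HolderConjugate m :=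
    (Real.HolderConjugate.conjExponent (by linarith)).symm
  have : (ENNReal.ofReal (m / (m - 1))).HolderConjugate (ENNReal.ofReal m) :=
    hconj.ennrealOfReal
  obtain ⟨C, hC⟩ := hη.bounded
  have P0 := ShiftPair.of_memLp (μ := volume) (by simp; linarith) ENNReal.ofReal_ne_top
    (hu.memLp_near hm) (hη.memLp hm)
  have P1 := ShiftPair.of_integrable_of_bound (μ := volume) (hu.integrable_far hm)
    (Ψ := fun z => η z.1) (hη.measurable.comp measurable_fst).aestronglyMeasurable
    (fun z => hC z.1)
  have P2 := ShiftPair.of_integrable_of_bound (μ := volume) (hu.integrable_far_swap hm)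
    (Ψ := fun z => η z.2) (hη.measurable.comp measurable_snd).aestronglyMeasurable
    (fun z => hC z.2)
  have hdiag : Tendsto (fun h : Space N => (h, h)) (𝓝 0) (𝓝 0) := by
    have : Continuous (fun h : Space N => (h, h)) := by fun_prop
    exact this.tendsto 0
  have hδ : 0 < r - r₀ := sub_pos.2 hr
  refine ⟨fun h hh => ?_, ?_, ?_⟩
  · refine (((P0.integrable (h, h)).add (P1.integrable (h, h))).sub
      (P2.integrable (h, h))).congr (.of_forall fun z => ?_)
    exact (formIntegrand_eq hm hrρ hη.support hh z).symm
  · obtain ⟨M₀, h0⟩ := P0.bound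
    obtain ⟨M₁, h1⟩ := P1.bound
    obtain ⟨M₂, h2⟩ := P2.bound
    refine ⟨M₀ + M₁ + M₂, fun h hh => ?_⟩
    refine le_trans ?_ (add_le_add (add_le_add (h0 (h, h)) (h1 (h, h))) (h2 (h, h)))
    refine le_trans (le_of_eq ?_) (integral_norm_add_sub_le (P0.integrable (h, h))
      (P1.integrable (h, h)) (P2.integrable (h, h)))
    exact integral_congr_ae (.of_forall fun z =>
      congrArg norm (formIntegrand_eq hm hrρ hη.support hh z))
  · have ht := ((P0.tendsto.add P1.tendsto).sub P2.tendsto)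
    have key : ∀ h : Space N, ‖h‖ ≤ r - r₀ → ∫ z, formIntegrand m κ u η h z = _ := fun h hh =>
      (integral_congr_ae (.of_forall fun z => formIntegrand_eq hm hrρ hη.support hh z)).trans
        (integral_add_sub (P0.integrable (h, h)) (P1.integrable (h, h)) (P2.integrable (h, h)))
    rw [key 0 (by simpa using hδ.le)]
    have ht' := ht.comp hdiag
    simp only [Prod.mk_zero_zero, sub_zero] at ht' ⊢
    refine ht'.congr' ?_
    filter_upwards [Metric.closedBall_mem_nhds (0 : Space N) hδ] with h hh
    rw [key h (by simpa using hh)]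
    simp

end Form

/-! ### Mollified test functions -/

section Mollify

variable {N : ℕ} {κ m r₀ r ρ : ℝ} {u η : Space N → ℝ}

/-- The average of the translates of `η` with weight `w`. -/
noncomputable def mollify (w η : Space N → ℝ) (x : Space N) : ℝ := ∫ h, w h * η (x - h)

/-- A smooth nonnegative weight of integral one supported in the ball of radius `δ`. -/
structure IsMollifier (δ : ℝ) (w : Space N → ℝ) : Prop where
  contDiff : ContDiff ℝ ∞ w
  compact : HasCompactSupport w
  nonneg : ∀ h, 0 ≤ w h
  support : ∀ h, δ < ‖h‖ → w h = 0
  integral_eq : ∫ h, w h = 1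

lemma exists_isMollifier (N : ℕ) {δ : ℝ} (hδ : 0 < δ) : ∃ w : Space N → ℝ, IsMollifier δ w := by
  let f : ContDiffBump (0 : Space N) := ⟨δ / 2, δ, by positivity, by linarith⟩
  refine ⟨f.normed volume, f.contDiff_normed, f.hasCompactSupport_normed, f.nonneg_normed,
    fun h hh => ?_, f.integral_normed⟩
  by_contra hne
  have : h ∈ Function.support (f.normed volume) := hne
  rw [f.support_normed_eq, mem_ball_zero_iff] at this
  exact absurd this (not_lt.2 hh.le)

variable {δ : ℝ} {w : Space N → ℝ}

lemma IsMollifier.integrable (hw : IsMollifier δ w) : Integrable w :=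
  hw.contDiff.continuous.integrable_of_hasCompactSupport hw.compact

lemma IsMollifier.integrable_mul (hw : IsMollifier δ w) (hη : Measurable η) {C : ℝ}
    (hC : ∀ x, |η x| ≤ C) (x : Space N) : Integrable (fun h => w h * η (x - h)) := by
  refine (hw.integrable.bdd_mul (f := fun h => η (x - h)) (c := C) ?_
    (.of_forall fun h => hC _)).congr
    (.of_forall fun h => mul_comm _ _)
  exact (hη.comp (measurable_const.sub measurable_id)).aestronglyMeasurable

lemma integrable_of_bounded_of_support (hη : Measurable η) {C : ℝ}
    (hC : ∀ x, |η x| ≤ C) (hs : ∀ x, r₀ < ‖x‖ → η x = 0) : Integrable η := by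
  have h : IntegrableOn η (closedBall 0 r₀) :=
    Measure.integrableOn_of_bounded (M := C) (measure_closedBall_lt_top).ne
      hη.aestronglyMeasurable (.of_forall hC)
  rwa [integrableOn_iff_integrable_of_support_subset] at h
  intro x hx
  by_contra hne
  exact hx (hs x (by simpa using hne))

lemma mollify_eq_zero (hw : IsMollifier δ w) (hs : ∀ x, r₀ < ‖x‖ → η x = 0) {x : Space N}
    (hx : r₀ + δ < ‖x‖) : mollify w η x = 0 := by
  refine integral_eq_zero_of_ae (.of_forall fun h => ?_)
  by_cases hh : δ < ‖h‖
  · simp [hw.support h hh]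
  · have := norm_sub_norm_le x h
    simp [hs (x - h) (by linarith)]

lemma isTestFunction_mollify (hw : IsMollifier δ w) (hη : Measurable η) {C : ℝ}
    (hC : ∀ x, |η x| ≤ C) (hs : ∀ x, r₀ < ‖x‖ → η x = 0) (hρ : r₀ + δ < ρ) :
    IsTestFunction (ball 0 ρ) (mollify w η) := by
  have hsub : tsupport (mollify w η) ⊆ closedBall 0 (r₀ + δ) := by
    refine closure_minimal (fun x hx => ?_) isClosed_closedBall
    by_contra hne
    exact hx (mollify_eq_zero hw hs (by simpa using hne))
  refine ⟨?_, HasCompactSupport.of_support_subset_isCompact (isCompact_closedBall 0 (r₀ + δ))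
    (subset_closure.trans hsub), hsub.trans (closedBall_subset_ball hρ)⟩
  exact hw.compact.contDiff_convolution_left (ContinuousLinearMap.lsmul ℝ ℝ) hw.contDiff
    (integrable_of_bounded_of_support hη hC hs).locallyIntegrable

lemma integral_mollify (hw : IsMollifier δ w) (hη : Measurable η) {C : ℝ}
    (hC : ∀ x, |η x| ≤ C) (hs : ∀ x, r₀ < ‖x‖ → η x = 0) :
    ∫ x, mollify w η x = ∫ x, η x := by
  have hI := integrable_of_bounded_of_support hη hC hs
  have h := (integral_weighted_swap (ν := volume) (μ := volume) hw.integrable hw.support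
    (H := fun a : Space N × Space N => η (a.2 - a.1)) hw.contDiff.continuous.measurable
    (hη.comp (measurable_snd.sub measurable_fst)) (fun h _ => hI.comp_sub_right h)
    (M := ∫ x, ‖η x‖)
    (fun h _ => (integral_sub_right_eq_self (fun x => ‖η x‖) h).le)).2
  simp only at h
  unfold mollify
  rw [h]
  simp_rw [integral_sub_right_eq_self η]
  rw [integral_mul_const, hw.integral_eq, one_mul]

lemma weakForm_mollify (s : ℝ) (hm : 2 ≤ m) (hr : r₀ < r) (hrρ : r < ρ)
    (hu : Admissible m (N + s * m) r ρ u) (hη : FiniteEnergy m (N + s * m) r₀ η)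
    (hδ : δ ≤ r - r₀) (hw : IsMollifier δ w) :
    Integrable (fun h => w h * ∫ z, formIntegrand m (N + s * m) u η h z) ∧
    weakForm s m u (mollify w η) = ∫ h, w h * ∫ z, formIntegrand m (N + s * m) u η h z := by
  obtain ⟨hint, ⟨M, hM⟩, -⟩ := formIntegrand_properties hm hr hrρ hu hη
  obtain ⟨C, hC⟩ := hη.bounded
  have h := integral_weighted_swap (ν := volume) (μ := volume) hw.integrable hw.support
    (H := fun a : Space N × (Space N × Space N) => formIntegrand m (N + s * m) u η a.1 a.2)
    hw.contDiff.continuous.measurable (measurable_formIntegrand hm hu.measurable hη.measurable)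
    (fun h hh => hint h (hh.trans hδ)) (fun h hh => hM h (hh.trans hδ))
  refine ⟨h.1, ?_⟩
  rw [← h.2]
  refine integral_congr_ae (.of_forall fun z => ?_)
  simp only [formIntegrand, mollify]
  rw [← integral_sub (hw.integrable_mul hη.measurable hC z.1)
    (hw.integrable_mul hη.measurable hC z.2), div_eq_mul_inv, ← integral_const_mul,
    ← integral_mul_const]
  refine integral_congr_ae (.of_forall fun h => ?_)
  simp only [ker]
  ring

/-- A weak inequality extends to nonnegative test functions of finite energy. -/
lemma le_integral_formIntegrand_of_test {s p q K : ℝ} (hp : 2 ≤ p) (hq : 2 ≤ q) (hr : r₀ < r)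
    (hrρ : r < ρ) (hup : Admissible p (N + s * p) r ρ u) (huq : Admissible q (N + s * q) r ρ u)
    (hηp : FiniteEnergy p (N + s * p) r₀ η) (hηq : FiniteEnergy q (N + s * q) r₀ η)
    (hη : ∀ x, 0 ≤ η x)
    (htest : ∀ φ : Space N → ℝ, IsTestFunction (ball 0 ρ) φ → (∀ x, 0 ≤ φ x) →
      ∫ x in ball 0 ρ, -K * φ x ≤ weakForm s p u φ + weakForm s q u φ) :
    -K * ∫ x, η x ≤
      (∫ z, formIntegrand p (N + s * p) u η 0 z) + ∫ z, formIntegrand q (N + s * q) u η 0 z := by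
  have hlim := (formIntegrand_properties hp hr hrρ hup hηp).2.2.add
    (formIntegrand_properties hq hr hrρ huq hηq).2.2
  obtain ⟨C, hC⟩ := hηp.bounded
  refine le_of_forall_pos_le_add fun ε hε => ?_
  obtain ⟨δ₁, hδ₁, hclose⟩ := Metric.eventually_nhds_iff_ball.1
    (hlim.eventually (eventually_le_nhds (lt_add_of_pos_right _ hε)))
  obtain ⟨δ, hδ0, hδ⟩ := exists_between (lt_min hδ₁ (sub_pos.2 hr))
  obtain ⟨w, hw⟩ := exists_isMollifier N hδ0
  have hδr : δ ≤ r - r₀ := hδ.le.trans (min_le_right _ _)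
  have h1 := weakForm_mollify s hp hr hrρ hup hηp hδr hw
  have h2 := weakForm_mollify s hq hr hrρ huq hηq hδr hw
  have htf : IsTestFunction (ball 0 ρ) (mollify w η) :=
    isTestFunction_mollify hw hηp.measurable hC hηp.support (by linarith)
  have ht := htest _ htf
    fun x => integral_nonneg fun h => mul_nonneg (hw.nonneg h) (hη _)
  rw [setIntegral_eq_integral_of_forall_compl_eq_zero, integral_const_mul,
    integral_mollify hw hηp.measurable hC hηp.support, h1.2, h2.2,
    ← integral_add h1.1 h2.1] at ht
  · refine ht.trans ?_
    -- On the support of `w` each form tested with a translate exceeds its value at `h = 0` by at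
    -- most `ε`, and the weight has mass one.
    calc _ ≤ ∫ h, w h * ((∫ z, formIntegrand p (N + s * p) u η 0 z) +
            (∫ z, formIntegrand q (N + s * q) u η 0 z) + ε) := by
          refine integral_mono (h1.1.add h2.1) (hw.integrable.mul_const _) fun h => ?_
          by_cases hh : δ < ‖h‖
          · simp [hw.support h hh]
          · simp only
            rw [← mul_add]
            refine mul_le_mul_of_nonneg_left (hclose h ?_) (hw.nonneg h)
            rw [mem_ball_zero_iff]
            exact (not_lt.1 hh).trans_lt (hδ.trans_le (min_le_left _ _))
      _ = _ := by rw [integral_mul_const, hw.integral_eq, one_mul]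
  · intro x hx
    have : x ∉ tsupport (mollify w η) := fun h => hx (htf.2.2 h)
    rw [image_eq_zero_of_notMem_tsupport this, mul_zero]

end Mollify

/-! ### Functions of finite energy -/

section Energy

variable {N : ℕ} {κ m r₀ r ρ : ℝ} {u v η : Space N → ℝ}

lemma rpow_le_two_rpow_mul {t a b c : ℝ} (ht : 0 ≤ t) (ha : 0 ≤ a) (hb : 0 ≤ b) (hc0 : 0 ≤ c)
    (hc : c ≤ a + b) : c ^ t ≤ 2 ^ t * (a ^ t + b ^ t) := by
  have h1 := Real.rpow_nonneg ha t
  have h2 := Real.rpow_nonneg hb t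
  have h3 : (0 : ℝ) ≤ 2 ^ t := by positivity
  rcases le_total a b with h | h
  · calc c ^ t ≤ (2 * b) ^ t := Real.rpow_le_rpow hc0 (by linarith) ht
      _ = 2 ^ t * b ^ t := Real.mul_rpow (by norm_num) hb
      _ ≤ _ := mul_le_mul_of_nonneg_left (by linarith) h3
  · calc c ^ t ≤ (2 * a) ^ t := Real.rpow_le_rpow hc0 (by linarith) ht
      _ = 2 ^ t * a ^ t := Real.mul_rpow (by norm_num) ha
      _ ≤ _ := mul_le_mul_of_nonneg_left (by linarith) h3

/-- The constant makes `‖y‖ - r ≥ (ρ - r) / (1 + ρ) * (1 + ‖y‖)` an equality at `‖y‖ = ρ`. -/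
lemma ker_le_of_far (hκ : 0 ≤ κ) (hr0 : 0 ≤ r) (hrρ : r < ρ) {x y : Space N} (hx : ‖x‖ ≤ r)
    (hy : ρ ≤ ‖y‖) :
    ker κ (x - y) ≤ (((ρ - r) / (1 + ρ)) ^ κ)⁻¹ * ((1 + ‖y‖) ^ κ)⁻¹ := by
  have hρ : 0 < 1 + ρ := by linarith
  have hc : 0 < (ρ - r) / (1 + ρ) := div_pos (by linarith) hρ
  rw [← mul_inv, ← Real.mul_rpow hc.le (by positivity)]
  refine ker_le_ker hκ (by positivity) ?_
  have h1 : ‖y‖ - ‖x‖ ≤ ‖x - y‖ := by rw [norm_sub_rev]; exact norm_sub_norm_le _ _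
  refine le_trans ?_ h1
  rw [div_mul_eq_mul_div, div_le_iff₀ hρ]
  nlinarith [mul_nonneg hr0 (norm_nonneg y)]

lemma admissible_of (hm : 2 ≤ m) (hκ : (N : ℝ) < κ) (hr0 : 0 ≤ r) (hrρ : r < ρ)
    (hu : Measurable u)
    (hnear : IntegrableOn (fun z : Space N × Space N => |u z.1 - u z.2| ^ m * ker κ (z.1 - z.2))
      (ball 0 ρ ×ˢ ball 0 ρ))
    (hloc : IntegrableOn (fun x => |u x| ^ (m - 1)) (closedBall 0 r))
    (htail : Integrable (fun x => |u x| ^ (m - 1) * ((1 + ‖x‖) ^ κ)⁻¹)) :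
    Admissible m κ r ρ u := by
  refine ⟨hu, hnear, ?_⟩
  have hκ0 : 0 ≤ κ := (Nat.cast_nonneg N).trans hκ.le
  have h1 : Integrable (fun z : Space N × Space N => |u z.1| ^ (m - 1) * ((1 + ‖z.2‖) ^ κ)⁻¹)
      ((volume.restrict (closedBall 0 r)).prod (volume.restrict (ball 0 ρ)ᶜ)) :=
    hloc.mul_prod (integrable_one_add_norm_rpow_inv hκ).integrableOn
  have h2 : Integrable (fun z : Space N × Space N =>
      (1 : ℝ) * (|u z.2| ^ (m - 1) * ((1 + ‖z.2‖) ^ κ)⁻¹))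
      ((volume.restrict (closedBall 0 r)).prod (volume.restrict (ball 0 ρ)ᶜ)) := by
    have h0 : IntegrableOn (fun _ : Space N => (1 : ℝ)) (closedBall 0 r) :=
      integrableOn_const measure_closedBall_lt_top.ne
    exact Integrable.mul_prod (f := fun _ : Space N => (1 : ℝ)) h0 htail.integrableOn
  have h := (h1.add h2).const_mul (2 ^ (m - 1) * (((ρ - r) / (1 + ρ)) ^ κ)⁻¹)
  rw [Measure.prod_restrict, ← Measure.volume_eq_prod] at h
  refine Integrable.mono' h ?_ ?_
  · exact (((measurable_diff hu).abs.pow_const _).mul measurable_ker_diff).aestronglyMeasurable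
  · filter_upwards [ae_restrict_mem (measurableSet_closedBall.prod measurableSet_ball.compl)]
      with z hz
    have hz1 : ‖z.1‖ ≤ r := by simpa using hz.1
    have hz2 : ρ ≤ ‖z.2‖ := by simpa using hz.2
    have hk := ker_le_of_far hκ0 hr0 hrρ hz1 hz2
    have hp := rpow_le_two_rpow_mul (t := m - 1) (by linarith) (abs_nonneg (u z.1))
      (abs_nonneg (u z.2)) (abs_nonneg _) (abs_sub (u z.1) (u z.2))
    rw [Real.norm_of_nonneg (mul_nonneg (by positivity) (ker_nonneg _ _))]
    refine (mul_le_mul hp hk (ker_nonneg _ _) (by positivity)).trans (le_of_eq ?_)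
    simp only [Pi.add_apply]
    ring

/-- The shear `(x, y) ↦ (x, y - x)` preserves measure and turns the integrand into a product. -/
lemma integrable_indicator_mul_diff {D : Set (Space N)} (hD : MeasurableSet D)
    (hDf : volume D ≠ ⊤) {f : Space N → ℝ} (hf : Integrable f) :
    Integrable fun z : Space N × Space N =>
      D.indicator (fun _ => (1 : ℝ)) z.1 * f (z.2 - z.1) := by
  have h1 : Integrable (D.indicator fun _ : Space N => (1 : ℝ)) :=
    (integrable_indicator_iff hD).2 (integrableOn_const hDf)
  have h2 := h1.mul_prod hf
  have h3 := (measurePreserving_prod_neg_add (μ := (volume : Measure (Space N)))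
    (ν := (volume : Measure (Space N)))).integrable_comp_of_integrable h2
  rw [Measure.volume_eq_prod]
  refine h3.congr (.of_forall fun z => ?_)
  simp [neg_add_eq_sub]

lemma finiteEnergy_of_smooth (hm : 2 ≤ m) (hN : 1 ≤ N) (hκ : (N : ℝ) < κ) (hκm : κ - m < N)
    (hv : ContDiff ℝ ∞ v) (hc : HasCompactSupport v) (hs : ∀ x, r₀ < ‖x‖ → v x = 0) :
    FiniteEnergy m κ r₀ v := by
  obtain ⟨K, hK⟩ := ContDiff.lipschitzWith_of_hasCompactSupport (𝕂 := ℝ) (n := ∞) hc hv (by simp)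
  obtain ⟨M, hM⟩ := hc.exists_bound_of_continuous hv.continuous
  refine ⟨hv.continuous.measurable, ⟨M, hM⟩, hs, ?_⟩
  have hI := integrable_indicator_mul_diff (measurableSet_closedBall (x := (0 : Space N))
    (ε := r₀)) measure_closedBall_lt_top.ne (integrable_truncKer (m := m) hN hκ hκm)
  refine ((hI.add hI.swap).const_mul ((K : ℝ) ^ m + (2 * M) ^ m)).mono'
    (((measurable_diff hv.continuous.measurable).abs.pow_const _).mul
      measurable_ker_diff).aestronglyMeasurable (.of_forall fun z => ?_)
  have hk := ker_nonneg κ (z.1 - z.2)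
  have hM0 : 0 ≤ M := (norm_nonneg _).trans (hM 0)
  have hA : 0 ≤ (K : ℝ) ^ m + (2 * M) ^ m :=
    add_nonneg (Real.rpow_nonneg K.coe_nonneg _) (by positivity)
  have hT := truncKer_nonneg m κ (z.1 - z.2)
  have hTs : truncKer m κ (z.2 - z.1) = truncKer m κ (z.1 - z.2) := by
    rw [truncKer, truncKer, ker_sub_comm, norm_sub_rev]
  have key : |v z.1 - v z.2| ^ m * ker κ (z.1 - z.2) ≤
      ((K : ℝ) ^ m + (2 * M) ^ m) * truncKer m κ (z.1 - z.2) := by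
    rw [truncKer, ← mul_assoc]
    exact mul_le_mul_of_nonneg_right (abs_sub_rpow_le_min (by linarith) hK hM _ _) hk
  rw [Real.norm_of_nonneg (mul_nonneg (by positivity) hk)]
  simp only [Pi.add_apply, Function.comp_apply, Prod.fst_swap, Prod.snd_swap, hTs]
  by_cases h1 : z.1 ∈ closedBall (0 : Space N) r₀
  · refine key.trans (mul_le_mul_of_nonneg_left ?_ hA)
    rw [Set.indicator_of_mem h1, one_mul]
    exact le_add_of_nonneg_right
      (mul_nonneg (Set.indicator_nonneg (fun _ _ => zero_le_one) _) hT)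
  by_cases h2 : z.2 ∈ closedBall (0 : Space N) r₀
  · refine key.trans (mul_le_mul_of_nonneg_left ?_ hA)
    rw [Set.indicator_of_mem h2, one_mul]
    exact le_add_of_nonneg_left
      (mul_nonneg (Set.indicator_nonneg (fun _ _ => zero_le_one) _) hT)
  · rw [hs _ (by simpa using h1), hs _ (by simpa using h2), Set.indicator_of_notMem h1,
      Set.indicator_of_notMem h2]
    simp [Real.zero_rpow (show m ≠ 0 by linarith)]

lemma FiniteEnergy.admissible (hm : 2 ≤ m) (hκ : (N : ℝ) < κ) (hr0 : 0 ≤ r) (hrρ : r < ρ)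
    (hv : FiniteEnergy m κ r₀ v) : Admissible m κ r ρ v := by
  obtain ⟨M, hM⟩ := hv.bounded
  have hb : ∀ x, |v x| ^ (m - 1) ≤ M ^ (m - 1) := fun x =>
    Real.rpow_le_rpow (abs_nonneg _) (hM x) (by linarith)
  have hmeas : Measurable fun x => |v x| ^ (m - 1) := hv.measurable.abs.pow_const _
  refine admissible_of hm hκ hr0 hrρ hv.measurable hv.energy.integrableOn ?_ ?_
  · refine Measure.integrableOn_of_bounded (M := M ^ (m - 1)) measure_closedBall_lt_top.ne
      hmeas.aestronglyMeasurable (.of_forall fun x => ?_)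
    rw [Real.norm_of_nonneg (by positivity)]
    exact hb x
  · refine (integrable_one_add_norm_rpow_inv hκ).bdd_mul (c := M ^ (m - 1))
      hmeas.aestronglyMeasurable (.of_forall fun x => ?_)
    rw [Real.norm_of_nonneg (by positivity)]
    exact hb x

/-- The energy of `u` is available only inside the ball of radius `ρ`. There the positive part is
controlled by the increments of both `v` and `u`. For every other pair, one point lies where `v` and
the positive part both vanish, and `0 ≤ (v - u)⁺ ≤ v` reduces the increment to that of `v`. -/
lemma finiteEnergy_posPart_sub (hm : 2 ≤ m) (hu : Admissible m κ r ρ u) (hu0 : ∀ x, 0 ≤ u x)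
    (hv0 : ∀ x, 0 ≤ v x) (hr : r₀ < ρ) (hv : FiniteEnergy m κ r₀ v) :
    FiniteEnergy m κ r₀ (fun x => max (v x - u x) 0) := by
  obtain ⟨M, hM⟩ := hv.bounded
  have hle : ∀ x, max (v x - u x) 0 ≤ v x := fun x => max_le (by linarith [hu0 x]) (hv0 x)
  have hz : ∀ x, r₀ < ‖x‖ → max (v x - u x) 0 = 0 := fun x hx =>
    le_antisymm ((hle x).trans (hv.support x hx).le) (le_max_right _ _)
  have hmeas : Measurable fun x => max (v x - u x) 0 :=
    (hv.measurable.sub hu.measurable).max measurable_const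
  refine ⟨hmeas, ⟨M, fun x => ?_⟩, hz, ?_⟩
  · rw [abs_of_nonneg (le_max_right _ _)]
    exact (hle x).trans ((le_abs_self _).trans (hM x))
  have hB : MeasurableSet (ball (0 : Space N) ρ ×ˢ ball (0 : Space N) ρ) :=
    measurableSet_ball.prod measurableSet_ball
  refine ((hv.energy.add ((integrable_indicator_iff hB).2 hu.near)).const_mul (2 ^ m)).mono'
    (((measurable_diff hmeas).abs.pow_const _).mul measurable_ker_diff).aestronglyMeasurable
    (.of_forall fun z => ?_)
  have hk := ker_nonneg κ (z.1 - z.2)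
  rw [Real.norm_of_nonneg (mul_nonneg (by positivity) hk)]
  simp only [Pi.add_apply]
  by_cases hzB : z ∈ ball (0 : Space N) ρ ×ˢ ball (0 : Space N) ρ
  · rw [Set.indicator_of_mem hzB, ← add_mul, ← mul_assoc]
    refine mul_le_mul_of_nonneg_right (rpow_le_two_rpow_mul (by linarith) (abs_nonneg _)
      (abs_nonneg _) (abs_nonneg _) ?_) hk
    refine (abs_max_sub_max_le_abs _ _ _).trans ?_
    rw [sub_sub_sub_comm]
    exact abs_sub _ _
  · rw [Set.indicator_of_notMem hzB, add_zero, ← mul_assoc]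
    refine mul_le_mul_of_nonneg_right ?_ hk
    have h2 : (1 : ℝ) ≤ 2 ^ m := Real.one_le_rpow (by norm_num) (by linarith)
    refine le_trans ?_ (le_mul_of_one_le_left (by positivity) h2)
    refine Real.rpow_le_rpow (abs_nonneg _) ?_ (by linarith)
    rw [Set.mem_prod, not_and_or, mem_ball_zero_iff, mem_ball_zero_iff, not_lt, not_lt] at hzB
    rcases hzB with h | h
    · have h' := hr.trans_le h
      rw [hz _ h', hv.support _ h', zero_sub, zero_sub, abs_neg, abs_neg,
        abs_of_nonneg (le_max_right _ _), abs_of_nonneg (hv0 _)]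
      exact hle _
    · have h' := hr.trans_le h
      rw [hz _ h', hv.support _ h', sub_zero, sub_zero,
        abs_of_nonneg (le_max_right _ _), abs_of_nonneg (hv0 _)]
      exact hle _

end Energy

/-! ### Upper bounds for the form tested with the truncated barrier -/

section Barrier

variable {N : ℕ} {κ m r₀ r ρ R : ℝ} {u v η : Space N → ℝ}

/-- A bound for the form of `v` obtained by symmetrizing the increments. -/
lemma integral_formIntegrand_le_of_symm (hm : 2 ≤ m) (hv : Measurable v) {M : ℝ}
    (hvM : ∀ x, |v x| ≤ M) (hη : Integrable η) (hη0 : ∀ x, 0 ≤ η x)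
    (hint : Integrable (formIntegrand m κ v η 0)) {b : Space N → ℝ}
    (hb : ∀ x h, J m (v x - v (x + h)) + J m (v x - v (x - h)) ≤ b h)
    (hbi : Integrable (fun h => b h * ker κ h)) :
    ∫ z, formIntegrand m κ v η 0 z ≤ (∫ h, b h * ker κ h) * ∫ x, η x := by
  have hmp : MeasurePreserving (fun z : Space N × Space N => (z.1, z.1 + z.2))
      (volume.prod volume) (volume.prod volume) :=
    measurePreserving_prod_add (volume : Measure (Space N)) (volume : Measure (Space N))
  have hemb : MeasurableEmbedding (fun z : Space N × Space N => (z.1, z.1 + z.2)) :=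
    (MeasurableEquiv.shearAddRight (Space N)).measurableEmbedding
  rw [Measure.volume_eq_prod] at hint ⊢
  have hint' : Integrable (fun z : Space N × Space N => formIntegrand m κ v η 0 (z.1, z.1 + z.2))
      (volume.prod volume) := hmp.integrable_comp_of_integrable hint
  have hJ : ∀ h : Space N, Measurable fun x => J m (v x - v (x + h)) := fun h =>
    (measurable_J hm).comp (hv.sub (hv.comp (measurable_id.add_const h)))
  have hJb : ∀ x y, ‖J m (v x - v y)‖ ≤ (2 * M) ^ (m - 1) := fun x y => by
    rw [Real.norm_eq_abs, abs_J hm]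
    refine Real.rpow_le_rpow (abs_nonneg _) ?_ (by linarith)
    linarith [abs_sub (v x) (v y), hvM x, hvM y]
  rw [← hmp.integral_comp hemb, integral_prod_symm _ hint', ← integral_mul_const]
  refine integral_mono hint'.integral_prod_right (hbi.mul_const _) fun h => ?_
  -- For fixed `h` the two halves are separately integrable in `x`, since `J` of the increments is
  -- bounded. They are recombined before integrating in `h`, where each alone could diverge at the
  -- singularity of the kernel.
  have i1 : Integrable fun x => J m (v x - v (x + h)) * η x :=
    hη.bdd_mul (hJ h).aestronglyMeasurable (.of_forall fun x => hJb _ _)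
  have i2 : Integrable fun x => J m (v x - v (x + h)) * η (x + h) :=
    (hη.comp_add_right h).bdd_mul (hJ h).aestronglyMeasurable (.of_forall fun x => hJb _ _)
  have e2 : ∫ x, J m (v x - v (x + h)) * η (x + h) = ∫ x, J m (v (x - h) - v x) * η x := by
    rw [← integral_sub_right_eq_self _ h]
    simp
  have i3 : Integrable fun x => J m (v (x - h) - v x) * η x := by
    refine (i2.comp_sub_right h).congr (.of_forall fun x => ?_)
    simp
  have hsplit : ∫ x, formIntegrand m κ v η 0 (x, x + h) =
      (∫ x, (J m (v x - v (x + h)) + J m (v x - v (x - h))) * η x) * ker κ h := by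
    have e3 : ∀ x, formIntegrand m κ v η 0 (x, x + h) =
        (J m (v x - v (x + h)) * η x - J m (v x - v (x + h)) * η (x + h)) * ker κ h := by
      intro x
      simp only [formIntegrand, sub_zero]
      rw [ker_sub_comm, add_sub_cancel_left]
      ring
    simp_rw [e3]
    rw [integral_mul_const, integral_sub i1 i2, e2, ← integral_sub i1 i3]
    congr 1
    refine integral_congr_ae (.of_forall fun x => ?_)
    simp only
    rw [J_sub_comm m (v (x - h))]
    ring
  have hfin : ∫ x, (J m (v x - v (x + h)) + J m (v x - v (x - h))) * η x ≤ b h * ∫ x, η x := by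
    rw [← integral_const_mul]
    refine integral_mono ?_ (hη.const_mul _)
      fun x => mul_le_mul_of_nonneg_right (hb x h) (hη0 x)
    refine (i1.sub i3).congr (.of_forall fun x => ?_)
    simp only [Pi.sub_apply]
    rw [J_sub_comm m (v (x - h))]
    ring
  calc _ = ∫ x, formIntegrand m κ v η 0 (x, x + h) := rfl
    _ ≤ (b h * ∫ x, η x) * ker κ h := by
        rw [hsplit]; exact mul_le_mul_of_nonneg_right hfin (ker_nonneg _ _)
    _ = _ := by ring

lemma formIntegrand_swap (x y : Space N) :
    formIntegrand m κ u η 0 (x, y) = formIntegrand m κ u η 0 (y, x) := by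
  simp only [formIntegrand, sub_zero]
  rw [J_sub_comm, ker_sub_comm]
  ring

/-- The gain density of the barrier argument. -/
noncomputable def gain (m a b ℓ : ℝ) (A : Set (Space N)) (u : Space N → ℝ) : Space N → ℝ :=
  A.indicator fun y => 2 * ℓ ^ (m - 1) * a - 2 ^ (1 - m) * b * u y ^ (m - 1)

/-- Off the annular set `A`, monotonicity of `J` suffices. If one point lies in `A`, then `v` and
the truncation vanish there: the form of `v` contributes a nonnegative term that may be kept on the
right, and `J_mul_posPart_le_of_nonneg` supplies the gain, with the upper kernel bound `a` on its
positive part and the lower bound `b` on its negative part. -/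
lemma formIntegrand_le (hm : 2 ≤ m) (hu0 : ∀ x, 0 ≤ u x) {ℓ : ℝ} (hv0 : ∀ x, 0 ≤ v x)
    (hvl : ∀ x, v x ≤ ℓ) (hs : ∀ x, r₀ < ‖x‖ → v x = 0) {A : Set (Space N)} {a b : ℝ}
    (hA : ∀ y ∈ A, r₀ < ‖y‖) (ha : ∀ x y, ‖x‖ ≤ r₀ → y ∈ A → ker κ (x - y) ≤ a)
    (hb : ∀ x y, ‖x‖ ≤ r₀ → y ∈ A → b ≤ ker κ (x - y)) (z : Space N × Space N) :
    formIntegrand m κ u (fun x => max (v x - u x) 0) 0 z ≤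
      formIntegrand m κ v (fun x => max (v x - u x) 0) 0 z +
        (max (v z.1 - u z.1) 0 * gain m a b ℓ A u z.2 +
          gain m a b ℓ A u z.1 * max (v z.2 - u z.2) 0) := by
  have hz : ∀ x, r₀ < ‖x‖ → max (v x - u x) 0 = 0 := fun x hx => by
    rw [hs x hx]; exact max_eq_right (by linarith [hu0 x])
  have key : ∀ x y, y ∈ A → formIntegrand m κ u (fun x => max (v x - u x) 0) 0 (x, y) ≤
      formIntegrand m κ v (fun x => max (v x - u x) 0) 0 (x, y) +
        (max (v x - u x) 0 * gain m a b ℓ A u y + gain m a b ℓ A u x * max (v y - u y) 0) := by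
    intro x y hy
    simp only [formIntegrand, sub_zero]
    rw [hz y (hA y hy), hs y (hA y hy), mul_zero, add_zero, sub_zero, sub_zero]
    by_cases hx : r₀ < ‖x‖
    · rw [hz x hx]; simp
    rw [not_lt] at hx
    have hk := ker_nonneg κ (x - y)
    have hη : 0 ≤ max (v x - u x) 0 := le_max_right _ _
    have h1 := mul_le_mul_of_nonneg_right
      (J_mul_posPart_le_of_nonneg hm (a := u x) (hu0 y) (hv0 x)) hk
    have hJ : 0 ≤ J m (v x) * max (v x - u x) 0 * ker κ (x - y) :=
      mul_nonneg (mul_nonneg (J_nonneg (hv0 x)) hη) hk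
    have h2 : 2 * v x ^ (m - 1) * ker κ (x - y) ≤ 2 * ℓ ^ (m - 1) * a := by
      have := Real.rpow_le_rpow (hv0 x) (hvl x) (show 0 ≤ m - 1 by linarith)
      exact mul_le_mul (by linarith) (ha x y hx hy) hk
        (mul_nonneg zero_le_two (Real.rpow_nonneg ((hv0 x).trans (hvl x)) _))
    have h3 : 2 ^ (1 - m) * b * u y ^ (m - 1) ≤
        2 ^ (1 - m) * u y ^ (m - 1) * ker κ (x - y) := by
      rw [mul_right_comm]
      exact mul_le_mul_of_nonneg_left (hb x y hx hy)
        (mul_nonneg (by positivity) (Real.rpow_nonneg (hu0 y) _))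
    rw [gain, Set.indicator_of_mem hy]
    nlinarith [mul_le_mul_of_nonneg_right (sub_le_sub h2 h3) hη]
  obtain ⟨x, y⟩ := z
  by_cases hy : y ∈ A
  · exact key x y hy
  by_cases hx : x ∈ A
  · rw [formIntegrand_swap, formIntegrand_swap (u := v)]
    refine (key y x hx).trans (le_of_eq ?_)
    simp only
    ring
  · simp only [gain, Set.indicator_of_notMem hx, Set.indicator_of_notMem hy, mul_zero, zero_mul,
      add_zero]
    simp only [formIntegrand, sub_zero]
    exact mul_le_mul_of_nonneg_right (J_mul_posPart_le hm _ _ _ _) (ker_nonneg _ _)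

lemma integral_formIntegrand_le (hm : 2 ≤ m) (hr : r₀ < r) (hrρ : r < ρ)
    (hu : Admissible m κ r ρ u) (hva : Admissible m κ r ρ v)
    (hη : FiniteEnergy m κ r₀ (fun x => max (v x - u x) 0))
    (hu0 : ∀ x, 0 ≤ u x) {ℓ : ℝ} (hv0 : ∀ x, 0 ≤ v x)
    (hvl : ∀ x, v x ≤ ℓ) (hs : ∀ x, r₀ < ‖x‖ → v x = 0) {A : Set (Space N)} {a b : ℝ}
    (hAm : MeasurableSet A) (hAf : volume A ≠ ⊤)
    (hA : ∀ y ∈ A, r₀ < ‖y‖) (ha : ∀ x y, ‖x‖ ≤ r₀ → y ∈ A → ker κ (x - y) ≤ a)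
    (hb : ∀ x y, ‖x‖ ≤ r₀ → y ∈ A → b ≤ ker κ (x - y))
    (huA : IntegrableOn (fun y => u y ^ (m - 1)) A) :
    ∫ z, formIntegrand m κ u (fun x => max (v x - u x) 0) 0 z ≤
      (∫ z, formIntegrand m κ v (fun x => max (v x - u x) 0) 0 z) +
        2 * (2 * ℓ ^ (m - 1) * a * volume.real A -
          2 ^ (1 - m) * b * ∫ y in A, u y ^ (m - 1)) * ∫ x, max (v x - u x) 0 := by
  obtain ⟨C, hC⟩ := hη.bounded
  have h0 : ‖(0 : Space N)‖ ≤ r - r₀ := by simpa using hr.le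
  have iu := (formIntegrand_properties hm hr hrρ hu hη).1 0 h0
  have iv := (formIntegrand_properties hm hr hrρ hva hη).1 0 h0
  have iη := integrable_of_bounded_of_support hη.measurable hC hη.support
  have hconst : IntegrableOn (fun _ : Space N => 2 * ℓ ^ (m - 1) * a) A := integrableOn_const hAf
  have hpow := huA.const_mul (2 ^ (1 - m) * b)
  have ig : Integrable (gain m a b ℓ A u) := (integrable_indicator_iff hAm).2 (hconst.sub hpow)
  have eg : ∫ y, gain m a b ℓ A u y = 2 * ℓ ^ (m - 1) * a * volume.real A -
      2 ^ (1 - m) * b * ∫ y in A, u y ^ (m - 1) := by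
    unfold gain
    rw [integral_indicator hAm, integral_sub hconst hpow, setIntegral_const,
      smul_eq_mul, mul_comm (volume.real A)]
    congr 1
    exact integral_const_mul _ _
  have i1 := iη.mul_prod ig
  have i2 := ig.mul_prod iη
  have e12 : ∫ z : Space N × Space N, (max (v z.1 - u z.1) 0 * gain m a b ℓ A u z.2 +
      gain m a b ℓ A u z.1 * max (v z.2 - u z.2) 0) =
      2 * (∫ y, gain m a b ℓ A u y) * ∫ x, max (v x - u x) 0 := by
    rw [Measure.volume_eq_prod]
    refine (integral_add i1 i2).trans ?_
    rw [integral_prod_mul (fun x => max (v x - u x) 0) (gain m a b ℓ A u),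
      integral_prod_mul (gain m a b ℓ A u) (fun x => max (v x - u x) 0)]
    ring
  rw [← eg, ← e12]
  refine (integral_mono iu (iv.add (i1.add i2))
    (formIntegrand_le hm hu0 hv0 hvl hs hA ha hb)).trans (le_of_eq ?_)
  exact integral_add iv (i1.add i2)

end Barrier

/-! ### The truncated barrier at scale `R` -/

section Scale

variable {N : ℕ} {s m R ℓ : ℝ} {u : Space N → ℝ}

/-- A cutoff equal to one on the ball of radius `1/4` and supported in the ball of radius
`3/10`. -/
noncomputable def cutoff (N : ℕ) : ContDiffBump (0 : Space N) :=
  ⟨1 / 4, 3 / 10, by norm_num, by norm_num⟩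

/-- The cutoff rescaled to radius `R` and height `ℓ`. -/
noncomputable def barrier (R ℓ : ℝ) (x : Space N) : ℝ := ℓ * cutoff N (R⁻¹ • x)

/-- The annulus between the balls of radii `R / 2` and `R`. -/
def annulus (N : ℕ) (R : ℝ) : Set (Space N) := ball 0 R \ ball 0 (R / 2)

lemma measurableSet_annulus (R : ℝ) : MeasurableSet (annulus N R) :=
  measurableSet_ball.diff measurableSet_ball

lemma volume_annulus_ne_top (R : ℝ) : volume (annulus N R) ≠ ⊤ :=
  ((measure_mono Set.sdiff_subset).trans_lt measure_ball_lt_top).ne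

lemma exists_volume_annulus (hN : 1 ≤ N) :
    ∃ α : ℝ, 0 < α ∧ ∀ R : ℝ, 0 < R → volume.real (annulus N R) = R ^ (N : ℝ) * α := by
  refine ⟨(1 - (1 / 2) ^ N) * volume.real (ball (0 : Space N) 1), ?_, fun R hR => ?_⟩
  · refine mul_pos (sub_pos.2 (pow_lt_one₀ (by norm_num) (by norm_num) (by omega))) ?_
    exact ENNReal.toReal_pos (measure_ball_pos _ _ one_pos).ne' measure_ball_lt_top.ne
  · have hb : ∀ t : ℝ, 0 < t → volume.real (ball (0 : Space N) t) =
        t ^ N * volume.real (ball (0 : Space N) 1) := fun t ht => by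
      rw [measureReal_def, Measure.addHaar_ball_of_pos _ _ ht, ENNReal.toReal_mul,
        ENNReal.toReal_ofReal (by positivity), finrank_euclideanSpace_fin, measureReal_def]
    rw [annulus, measureReal_sdiff (ball_subset_ball (by linarith)) measurableSet_ball,
      hb R hR, hb _ (half_pos hR), Real.rpow_natCast, div_pow, div_pow, one_pow]
    ring

lemma barrier_nonneg (hℓ : 0 ≤ ℓ) (x : Space N) : 0 ≤ barrier R ℓ x :=
  mul_nonneg hℓ (cutoff N).nonneg

lemma barrier_le (hℓ : 0 ≤ ℓ) (x : Space N) : barrier R ℓ x ≤ ℓ :=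
  mul_le_of_le_one_right hℓ (cutoff N).le_one

lemma barrier_eq (hR : 0 < R) {x : Space N} (hx : ‖x‖ ≤ R / 4) : barrier R ℓ x = ℓ := by
  rw [barrier, (cutoff N).one_of_mem_closedBall, mul_one]
  rw [mem_closedBall_zero_iff, norm_smul, norm_inv, Real.norm_of_nonneg hR.le,
    ← div_eq_inv_mul, div_le_iff₀ hR]
  change _ ≤ 1 / 4 * R
  linarith

lemma barrier_eq_zero (hR : 0 < R) {x : Space N} (hx : 3 / 10 * R < ‖x‖) :
    barrier R ℓ x = 0 := by
  rw [barrier, (cutoff N).zero_of_le_dist, mul_zero]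
  rw [dist_zero_right, norm_smul, norm_inv, Real.norm_of_nonneg hR.le,
    ← div_eq_inv_mul, le_div_iff₀ hR]
  exact hx.le

lemma contDiff_barrier : ContDiff ℝ ∞ (barrier R ℓ : Space N → ℝ) :=
  contDiff_const.mul ((cutoff N).contDiff.comp (contDiff_const_smul _))

lemma hasCompactSupport_barrier (hR : 0 < R) :
    HasCompactSupport (barrier R ℓ : Space N → ℝ) := by
  refine HasCompactSupport.of_support_subset_isCompact
    (isCompact_closedBall (0 : Space N) (3 / 10 * R)) fun x hx => ?_
  by_contra hne
  exact hx (barrier_eq_zero hR (by simpa using hne))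

lemma finiteEnergy_barrier (hN : 1 ≤ N) (hs0 : 0 < s) (hs1 : s < 1) (hm : 2 ≤ m) (hR : 0 < R) :
    FiniteEnergy m (N + s * m) (3 / 10 * R) (barrier R ℓ : Space N → ℝ) :=
  finiteEnergy_of_smooth hm hN (by nlinarith) (by nlinarith) contDiff_barrier
    (hasCompactSupport_barrier hR) fun _ => barrier_eq_zero hR

lemma finiteEnergy_truncated_barrier (hN : 1 ≤ N) (hs0 : 0 < s) (hs1 : s < 1) (hm : 2 ≤ m)
    (hR : 0 < R) (hℓ : 0 ≤ ℓ) (hu : Admissible m (N + s * m) (8 / 25 * R) (R / 3) u)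
    (hu0 : ∀ x, 0 ≤ u x) :
    FiniteEnergy m (N + s * m) (3 / 10 * R) fun x => max (barrier R ℓ x - u x) 0 :=
  finiteEnergy_posPart_sub hm hu hu0 (barrier_nonneg hℓ) (by linarith)
    (finiteEnergy_barrier hN hs0 hs1 hm hR)

/-- The form of a nonnegative function tested with the truncated barrier. -/
lemma exists_integral_formIntegrand_barrier_le (hN : 1 ≤ N) (hs0 : 0 < s) (hs1 : s < 1)
    (hm : 2 ≤ m) :
    ∃ C c : ℝ, 0 ≤ C ∧ 0 < c ∧ ∀ (R ℓ : ℝ) (u : Space N → ℝ), 0 < R → 0 < ℓ →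
      (∀ x, 0 ≤ u x) → Admissible m (N + s * m) (8 / 25 * R) (R / 3) u →
      IntegrableOn (fun y => u y ^ (m - 1)) (annulus N R) →
      ∫ z, formIntegrand m (N + s * m) u (fun x => max (barrier R ℓ x - u x) 0) 0 z ≤
        (R ^ (s * m))⁻¹ * (C * ℓ ^ (m - 1) - c * ⨍ y in annulus N R, u y ^ (m - 1)) *
          ∫ x, max (barrier R ℓ x - u x) 0 := by
  have hκ : (N : ℝ) < N + s * m := by nlinarith
  have hκm : N + s * m - m < (N : ℝ) := by nlinarith
  obtain ⟨C₁, hC₁, hsym⟩ := exists_J_add_J_le hm (cutoff N).contDiff (cutoff N).hasCompactSupport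
  obtain ⟨α, hα, hvol⟩ := exists_volume_annulus hN
  set κ : ℝ := N + s * m with hκdef
  have hI : 0 ≤ ∫ x : Space N, truncKer m κ x := integral_nonneg (truncKer_nonneg m κ)
  -- For `x` in the support of the barrier and `y` in the annulus, `R / 6 ≤ ‖x - y‖ ≤ 2 * R`; this
  -- yields `6 ^ κ` and `(2 ^ κ)⁻¹`. The pair may occur in either order, which doubles both gain
  -- terms. The powers of `R` combine to `R ^ (-κ) * R ^ N = R ^ (-s m)`.
  refine ⟨C₁ * (∫ x : Space N, truncKer m κ x) + 4 * 6 ^ κ * α,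
    2 * 2 ^ (1 - m) * (2 ^ κ)⁻¹ * α, by positivity, by positivity, ?_⟩
  intro R ℓ u hR hℓ hu0 hu huA
  have hv := finiteEnergy_barrier (N := N) (ℓ := ℓ) hN hs0 hs1 hm hR
  have hva : Admissible m κ (8 / 25 * R) (R / 3) (barrier R ℓ : Space N → ℝ) :=
    hv.admissible hm hκ (by positivity) (by linarith)
  have hη := finiteEnergy_truncated_barrier hN hs0 hs1 hm hR hℓ.le hu hu0
  obtain ⟨M, hM⟩ := hη.bounded
  have iη := integrable_of_bounded_of_support hη.measurable hM hη.support
  have hr : 3 / 10 * R < 8 / 25 * R := by linarith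
  have hrρ : 8 / 25 * R < R / 3 := by linarith
  have hann : ∀ y ∈ annulus N R, R / 2 ≤ ‖y‖ ∧ ‖y‖ < R := fun y hy =>
    ⟨by simpa using hy.2, by simpa using hy.1⟩
  have hκ0 : 0 ≤ κ := (Nat.cast_nonneg N).trans hκ.le
  have hfar : ∀ x y : Space N, ‖x‖ ≤ 3 / 10 * R → y ∈ annulus N R → R / 6 ≤ ‖x - y‖ :=
    fun x y hx hy => by
      have h1 := norm_sub_norm_le y x
      rw [norm_sub_rev] at h1
      linarith [(hann y hy).1]
  have h1 := integral_formIntegrand_le (κ := κ) (a := ((R / 6) ^ κ)⁻¹) (b := ((2 * R) ^ κ)⁻¹)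
    hm hr hrρ hu hva hη hu0
    (barrier_nonneg hℓ.le) (barrier_le hℓ.le) (fun _ => barrier_eq_zero hR)
    (measurableSet_annulus R) (volume_annulus_ne_top R)
    (fun y hy => by linarith [(hann y hy).1])
    (fun x y hx hy => ker_le_ker hκ0 (by positivity) (hfar x y hx hy))
    (fun x y hx hy => by
      refine le_ker hκ0 ((show 0 < R / 6 by positivity).trans_le (hfar x y hx hy)) ?_
      linarith [norm_sub_le x y, (hann y hy).2]) huA
  have h2 := integral_formIntegrand_le_of_symm (κ := κ)
    (v := (barrier R ℓ : Space N → ℝ)) (M := ℓ)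
    (b := fun h => C₁ * ℓ ^ (m - 1) * min (‖R⁻¹ • h‖ ^ m) 1) hm hv.measurable
    (fun x => by
      rw [abs_of_nonneg (barrier_nonneg hℓ.le x)]
      exact barrier_le hℓ.le x)
    iη (fun x => le_max_right _ _)
    ((formIntegrand_properties hm hr hrρ hva hη).1 0 (by simpa using hr.le))
    (fun x h => by
      have e : ∀ y : Space N, J m (barrier R ℓ x - barrier R ℓ y) =
          ℓ ^ (m - 1) * J m (cutoff N (R⁻¹ • x) - cutoff N (R⁻¹ • y)) := fun y => by
        rw [barrier, barrier, ← mul_sub, J_mul m hℓ]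
      rw [e, e, smul_add, smul_sub, ← mul_add, mul_right_comm, mul_comm (C₁ * _)]
      exact mul_le_mul_of_nonneg_left ((le_abs_self _).trans (hsym _ _))
        (Real.rpow_nonneg hℓ.le _))
    (by
      simp_rw [mul_assoc]
      exact ((integrable_min_smul_mul_ker hN hκ hκm hR).const_mul _).const_mul _)
  have e2 : ∫ h : Space N, C₁ * ℓ ^ (m - 1) * min (‖R⁻¹ • h‖ ^ m) 1 * ker κ h =
      (R ^ (s * m))⁻¹ * (C₁ * (∫ x : Space N, truncKer m κ x) * ℓ ^ (m - 1)) := by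
    simp_rw [mul_assoc (C₁ * ℓ ^ (m - 1))]
    rw [integral_const_mul, integral_min_smul_mul_ker hR, hκdef, add_sub_cancel_left]
    ring
  have hRN : (R ^ κ)⁻¹ * R ^ (N : ℝ) = (R ^ (s * m))⁻¹ := by
    have := (Real.rpow_pos_of_pos hR (N : ℝ)).ne'
    rw [hκdef, Real.rpow_add hR, mul_inv, mul_right_comm, inv_mul_cancel₀ this, one_mul]
  have hαR : volume.real (annulus N R) ≠ 0 := by
    rw [hvol R hR]
    exact (mul_pos (Real.rpow_pos_of_pos hR _) hα).ne'
  have eavg : ∫ y in annulus N R, u y ^ (m - 1) =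
      R ^ (N : ℝ) * α * ⨍ y in annulus N R, u y ^ (m - 1) := by
    rw [setAverage_eq, smul_eq_mul, ← hvol R hR, mul_inv_cancel_left₀ hαR]
  rw [e2] at h2
  rw [eavg, hvol R hR, Real.div_rpow hR.le (by norm_num), Real.mul_rpow (by norm_num) hR.le,
    inv_div] at h1
  refine h1.trans ((add_le_add_left h2 _).trans (le_of_eq ?_))
  rw [← hRN]
  ring

end Scale

/-! ### Passing to a measurable nonnegative representative -/

section Representative

variable {N : ℕ} {s m r ρ : ℝ} {u v : Space N → ℝ}

lemma MemLmLoc.aemeasurable (hu : MemLmLoc m u) : AEMeasurable u := by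
  have h : AEMeasurable u (volume.restrict (⋃ n : ℕ, closedBall (0 : Space N) n)) :=
    aemeasurable_iUnion_iff.2 fun n => (hu _ (isCompact_closedBall 0 n)).1.aemeasurable
  rwa [iUnion_closedBall_nat, Measure.restrict_univ] at h

lemma MemLmLoc.integrableOn_rpow (hm : 2 ≤ m) (hu : MemLmLoc m u) (huv : u =ᵐ[volume] v)
    {A : Set (Space N)} (hA : IsCompact A) : IntegrableOn (fun x => |v x| ^ (m - 1)) A := by
  have : IsFiniteMeasure (volume.restrict A) := ⟨by simpa using hA.measure_lt_top⟩
  have h : MemLp v (ENNReal.ofReal m) (volume.restrict A) :=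
    (memLp_congr_ae (ae_restrict_of_ae huv)).1 (hu A hA)
  have h' := (h.mono_exponent (p := ENNReal.ofReal (m - 1))
    (ENNReal.ofReal_le_ofReal (by linarith))).integrable_norm_rpow
    (by simp; linarith) ENNReal.ofReal_ne_top
  rwa [ENNReal.toReal_ofReal (by linarith)] at h'

lemma MemWTilde.admissible (hm : 2 ≤ m) (hs0 : 0 < s) (hr0 : 0 ≤ r) (hrρ : r < ρ)
    (hu : MemWTilde s m (ball 0 ρ) u) (huv : u =ᵐ[volume] v) (hv : Measurable v) :
    Admissible m (N + s * m) r ρ v := by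
  obtain ⟨hloc, htail, U, -, -, hU, -, hgag⟩ := hu
  have hBU : ball (0 : Space N) ρ ⊆ U := subset_closure.trans hU
  refine admissible_of hm (by nlinarith) hr0 hrρ hv ?_
    (hloc.integrableOn_rpow hm huv (isCompact_closedBall 0 r)) ?_
  · have hmeas : Measurable fun z : Space N × Space N =>
        |v z.1 - v z.2| ^ m * ker (N + s * m) (z.1 - z.2) :=
      ((measurable_diff hv).abs.pow_const _).mul measurable_ker_diff
    refine (lintegral_ofReal_ne_top_iff_integrable hmeas.aestronglyMeasurable
      (.of_forall fun z => mul_nonneg (by positivity) (ker_nonneg _ _))).1 ?_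
    rw [Measure.volume_eq_prod, ← Measure.prod_restrict,
      lintegral_prod _ hmeas.ennreal_ofReal.aemeasurable]
    refine ne_top_of_le_ne_top hgag.ne ?_
    refine le_trans (lintegral_mono_ae ?_) (lintegral_mono_set hBU)
    have huB : ∀ᵐ x ∂volume.restrict (ball (0 : Space N) ρ), u x = v x := ae_restrict_of_ae huv
    filter_upwards [huB] with x hx
    refine le_trans (lintegral_mono_ae ?_) (lintegral_mono_set hBU)
    filter_upwards [huB] with y hy
    rw [hx, hy, ker, div_eq_mul_inv]
  · have hmeas : Measurable fun x : Space N =>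
        |v x| ^ (m - 1) * ((1 + ‖x‖) ^ ((N : ℝ) + s * m))⁻¹ := by fun_prop
    refine (lintegral_ofReal_ne_top_iff_integrable hmeas.aestronglyMeasurable
      (.of_forall fun z => by positivity)).1 ?_
    refine ne_top_of_le_ne_top htail.ne (lintegral_mono_ae ?_)
    filter_upwards [huv] with x hx
    rw [hx, div_eq_mul_inv]

lemma weakForm_congr (φ : Space N → ℝ) (huv : u =ᵐ[volume] v) :
    weakForm s m u φ = weakForm s m v φ := by
  refine integral_congr_ae ?_
  rw [Measure.volume_eq_prod]
  filter_upwards [Measure.quasiMeasurePreserving_fst.ae_eq_comp huv,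
    Measure.quasiMeasurePreserving_snd.ae_eq_comp huv] with z h1 h2
  simp only [Function.comp_apply] at h1 h2
  rw [h1, h2]

end Representative

/-! ### Essential infimum and averages -/

/-- The real `essInf` is meaningful only if the almost-everywhere lower bounds are bounded above.
This holds because a real function is at most some integer `n` on a set that is not null. -/
lemma le_essInf_of_ae_le_real {X : Type*} [MeasurableSpace X] {μ : Measure X} (hμ : μ ≠ 0)
    {u : X → ℝ} {c : ℝ} (h : ∀ᵐ x ∂μ, c ≤ u x) : c ≤ essInf u μ := by
  have : (ae μ).NeBot := ae_neBot.2 hμ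
  refine le_liminf_of_le ?_ h
  have hex : ∃ n : ℕ, ∃ᶠ x in ae μ, u x ≤ n := by
    by_contra hne
    simp only [not_exists, not_frequently, not_le] at hne
    obtain ⟨x, hx⟩ := (eventually_countable_forall.2 hne).exists
    obtain ⟨n, hn⟩ := exists_nat_ge (u x)
    exact absurd (hx n) (not_lt.2 hn)
  obtain ⟨n, hn⟩ := hex
  refine ⟨n, fun a ha => ?_⟩
  obtain ⟨x, hx, hax⟩ := (hn.and_eventually (eventually_map.1 ha)).exists
  exact hax.trans hx

/-- Jensen's inequality for `t ↦ t ^ ((p - 1) / (q - 1))`; this is where `q ≤ p` enters. -/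
lemma rpow_average_le {X : Type*} [MeasurableSpace X] {μ : Measure X} [IsFiniteMeasure μ]
    (hμ : μ ≠ 0) {u : X → ℝ} (hu : ∀ x, 0 ≤ u x) {p q : ℝ} (hq : 2 ≤ q) (hqp : q ≤ p)
    (hiq : Integrable (fun x => u x ^ (q - 1)) μ) (hip : Integrable (fun x => u x ^ (p - 1)) μ) :
    ((⨍ x, u x ^ (q - 1) ∂μ) ^ (1 / (q - 1))) ^ (p - 1) ≤ ⨍ x, u x ^ (p - 1) ∂μ := by
  have : NeZero μ := ⟨hμ⟩
  have ht : 1 ≤ (p - 1) / (q - 1) := by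
    rw [one_le_div (by linarith)]; linarith
  have e : ∀ x, (u x ^ (q - 1)) ^ ((p - 1) / (q - 1)) = u x ^ (p - 1) := fun x => by
    rw [← Real.rpow_mul (hu x), mul_div_cancel₀ _ (by linarith)]
  have h := (convexOn_rpow ht).map_average_le (μ := μ) (f := fun x => u x ^ (q - 1))
    (Real.continuous_rpow_const (by linarith)).continuousOn isClosed_Ici
    (.of_forall fun x => Real.rpow_nonneg (hu x) _) hiq (by
      refine hip.congr (.of_forall fun x => (e x).symm))
  simp only [e] at h
  have h0 : 0 ≤ ⨍ x, u x ^ (q - 1) ∂μ := integral_nonneg fun x => Real.rpow_nonneg (hu x) _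
  rw [← Real.rpow_mul h0, one_div_mul_eq_div]
  exact h

/-! ### The weak Harnack inequality for measurable nonnegative representatives -/

/-- The barrier alternative: either the truncated barrier vanishes almost everywhere, or the
forcing term controls the average. -/
lemma ae_le_or_rpow_le {N : ℕ} {s p q R K ℓ L Cp Cq cp cq : ℝ} {u : Space N → ℝ} (hN : 1 ≤ N)
    (hs0 : 0 < s) (hs1 : s < 1) (hq : 2 ≤ q) (hqp : q ≤ p) (hR : 0 < R) (hℓ : 0 < ℓ)
    (hL : 0 ≤ L) (hu0 : ∀ x, 0 ≤ u x)
    (hup : Admissible p (N + s * p) (8 / 25 * R) (R / 3) u)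
    (huq : Admissible q (N + s * q) (8 / 25 * R) (R / 3) u)
    (htest : ∀ φ : Space N → ℝ, IsTestFunction (ball 0 (R / 3)) φ → (∀ x, 0 ≤ φ x) →
      ∫ x in ball 0 (R / 3), -K * φ x ≤ weakForm s p u φ + weakForm s q u φ)
    (hp' : ∫ z, formIntegrand p (N + s * p) u (fun x => max (barrier R ℓ x - u x) 0) 0 z ≤
      (R ^ (s * p))⁻¹ * (Cp * ℓ ^ (p - 1) - cp * ⨍ y in annulus N R, u y ^ (p - 1)) *
        ∫ x, max (barrier R ℓ x - u x) 0)
    (hq' : ∫ z, formIntegrand q (N + s * q) u (fun x => max (barrier R ℓ x - u x) 0) 0 z ≤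
      (R ^ (s * q))⁻¹ * (Cq * ℓ ^ (q - 1) - cq * ⨍ y in annulus N R, u y ^ (q - 1)) *
        ∫ x, max (barrier R ℓ x - u x) 0)
    (hcp : 0 < cp) (hcq : 0 < cq)
    (hLp : L ^ (p - 1) ≤ ⨍ y in annulus N R, u y ^ (p - 1))
    (hLq : L ^ (q - 1) ≤ ⨍ y in annulus N R, u y ^ (q - 1))
    (hℓp : Cp * ℓ ^ (p - 1) ≤ cp / 2 * L ^ (p - 1))
    (hℓq : Cq * ℓ ^ (q - 1) ≤ cq / 2 * L ^ (q - 1)) :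
    (∀ᵐ x, barrier R ℓ x ≤ u x) ∨ L ^ (p - 1) ≤ 2 / cp * (K * R ^ (s * p)) := by
  have hp : 2 ≤ p := hq.trans hqp
  have hηp := finiteEnergy_truncated_barrier hN hs0 hs1 hp hR hℓ.le hup hu0
  have hηq := finiteEnergy_truncated_barrier hN hs0 hs1 hq hR hℓ.le huq hu0
  obtain ⟨M, hM⟩ := hηp.bounded
  have iη := integrable_of_bounded_of_support hηp.measurable hM hηp.support
  have h := le_integral_formIntegrand_of_test hp hq (by linarith) (by linarith) hup huq hηp hηq
    (fun x => le_max_right _ _) htest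
  have hη0 : 0 ≤ ∫ x, max (barrier R ℓ x - u x) 0 := integral_nonneg fun x => le_max_right _ _
  rcases hη0.eq_or_lt with h0 | h0
  · left
    have hz := (integral_eq_zero_iff_of_nonneg (fun x => le_max_right _ _) iη).1 h0.symm
    filter_upwards [hz] with x hx
    have : barrier R ℓ x - u x ≤ 0 := max_eq_right_iff.1 hx
    linarith
  · right
    have h1 := h.trans (add_le_add hp' hq')
    rw [← add_mul] at h1
    have h2 := le_of_mul_le_mul_right h1 h0
    have hRp : 0 < R ^ (s * p) := Real.rpow_pos_of_pos hR _
    have hRq : 0 < (R ^ (s * q))⁻¹ := inv_pos.2 (Real.rpow_pos_of_pos hR _)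
    -- The `q` contribution has a favourable sign and is discarded, so only the scale `R ^ (s * p)`
    -- survives.
    have hnegq : (R ^ (s * q))⁻¹ *
        (Cq * ℓ ^ (q - 1) - cq * ⨍ y in annulus N R, u y ^ (q - 1)) ≤ 0 := by
      refine mul_nonpos_of_nonneg_of_nonpos hRq.le ?_
      have := Real.rpow_nonneg hL (q - 1)
      nlinarith
    have h3 : (R ^ (s * p))⁻¹ * (Cp * ℓ ^ (p - 1) - cp * ⨍ y in annulus N R, u y ^ (p - 1)) ≤
        (R ^ (s * p))⁻¹ * (-(cp / 2 * L ^ (p - 1))) := by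
      refine mul_le_mul_of_nonneg_left ?_ (inv_pos.2 hRp).le
      nlinarith
    have h4 : (R ^ (s * p))⁻¹ * (cp / 2 * L ^ (p - 1)) ≤ K := by linarith
    rw [inv_mul_le_iff₀ hRp] at h4
    rw [div_mul_eq_mul_div, le_div_iff₀ hcp]
    linarith

/-- The weak Harnack inequality for a measurable, everywhere nonnegative function. -/
lemma weak_harnack_of_measurable (N : ℕ) (hN : 1 ≤ N) (s p q : ℝ) (hs0 : 0 < s) (hs1 : s < 1)
    (hq : 2 ≤ q) (hqp : q ≤ p) :
    ∃ σ C : ℝ, 0 < σ ∧ σ < 1 ∧ 0 < C ∧ ∀ (R K : ℝ) (u : Space N → ℝ), 0 < R → 0 ≤ K →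
      (∀ x, 0 ≤ u x) → Admissible p (N + s * p) (8 / 25 * R) (R / 3) u →
      Admissible q (N + s * q) (8 / 25 * R) (R / 3) u →
      IntegrableOn (fun y => u y ^ (p - 1)) (annulus N R) →
      IntegrableOn (fun y => u y ^ (q - 1)) (annulus N R) →
      (∀ φ : Space N → ℝ, IsTestFunction (ball 0 (R / 3)) φ → (∀ x, 0 ≤ φ x) →
        ∫ x in ball 0 (R / 3), -K * φ x ≤ weakForm s p u φ + weakForm s q u φ) →
      σ * (⨍ y in annulus N R, u y ^ (q - 1)) ^ (1 / (q - 1)) -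
          C * (K * R ^ (s * p)) ^ (1 / (p - 1)) ≤
        essInf u (volume.restrict (ball 0 (R / 4))) := by
  have hp : 2 ≤ p := hq.trans hqp
  obtain ⟨Cp, cp, hCp, hcp, Hp⟩ := exists_integral_formIntegrand_barrier_le hN hs0 hs1 hp
  obtain ⟨Cq, cq, hCq, hcq, Hq⟩ := exists_integral_formIntegrand_barrier_le hN hs0 hs1 hq
  obtain ⟨α, hα, hvol⟩ := exists_volume_annulus hN
  -- As `σ ≤ 1` and `m ≥ 2`, `σ ^ (m - 1) ≤ σ`, so `C * σ ≤ c / 2` absorbs half of the gain. The `+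
  -- 1` covers a vanishing constant `C`.
  set σ := min (1 / 2) (min (cp / 2 / (Cp + 1)) (cq / 2 / (Cq + 1))) with hσ
  have hσ0 : 0 < σ := by rw [hσ]; positivity
  have hσ1 : σ ≤ 1 / 2 := min_le_left _ _
  have hσp : Cp * σ ≤ cp / 2 := by
    have : σ ≤ cp / 2 / (Cp + 1) := (min_le_right _ _).trans (min_le_left _ _)
    rw [le_div_iff₀ (by positivity)] at this
    linarith
  have hσq : Cq * σ ≤ cq / 2 := by
    have : σ ≤ cq / 2 / (Cq + 1) := (min_le_right _ _).trans (min_le_right _ _)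
    rw [le_div_iff₀ (by positivity)] at this
    linarith
  refine ⟨σ, (2 / cp) ^ (1 / (p - 1)), hσ0, by linarith, by positivity, ?_⟩
  intro R K u hR hK hu0 hup huq hip hiq htest
  set a := ⨍ y in annulus N R, u y ^ (q - 1) with ha
  have ha0 : 0 ≤ a := integral_nonneg fun x => Real.rpow_nonneg (hu0 x) _
  set L := a ^ (1 / (q - 1)) with hL
  have hL0 : 0 ≤ L := Real.rpow_nonneg ha0 _
  have hball : volume.restrict (ball (0 : Space N) (R / 4)) ≠ 0 := by
    rw [Ne, Measure.restrict_eq_zero]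
    exact (measure_ball_pos _ _ (by positivity)).ne'
  have hE : 0 ≤ (2 / cp) ^ (1 / (p - 1)) * (K * R ^ (s * p)) ^ (1 / (p - 1)) := by positivity
  rcases hL0.eq_or_lt with hLz | hLpos
  -- With `L = 0` there is no barrier of positive height, but the claim reduces to `u ≥ 0`.
  · rw [← hLz, mul_zero]
    exact (by linarith : _ ≤ (0 : ℝ)).trans (le_essInf_of_ae_le_real hball (.of_forall hu0))
  have hann : volume.restrict (annulus N R) ≠ 0 := by
    rw [Ne, Measure.restrict_eq_zero]
    intro h0
    have := hvol R hR
    rw [measureReal_def, h0, ENNReal.toReal_zero] at this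
    exact (mul_pos (Real.rpow_pos_of_pos hR _) hα).ne this
  have : IsFiniteMeasure (volume.restrict (annulus N R)) :=
    ⟨by simpa using (volume_annulus_ne_top R).lt_top⟩
  have hLp : L ^ (p - 1) ≤ ⨍ y in annulus N R, u y ^ (p - 1) :=
    rpow_average_le hann hu0 hq hqp hiq hip
  have hLq : L ^ (q - 1) ≤ a := by
    rw [hL, ← Real.rpow_mul ha0, one_div_mul_cancel (by linarith), Real.rpow_one]
  have hpow : ∀ m : ℝ, 2 ≤ m → (σ * L) ^ (m - 1) ≤ σ * L ^ (m - 1) := fun m hm => by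
    rw [Real.mul_rpow hσ0.le hL0]
    refine mul_le_mul_of_nonneg_right ?_ (Real.rpow_nonneg hL0 _)
    calc σ ^ (m - 1) ≤ σ ^ (1 : ℝ) :=
          Real.rpow_le_rpow_of_exponent_ge hσ0 (by linarith) (by linarith)
      _ = σ := Real.rpow_one σ
  have hℓ : 0 < σ * L := mul_pos hσ0 hLpos
  have hbound : ∀ m C c : ℝ, 2 ≤ m → 0 ≤ C → C * σ ≤ c / 2 →
      C * (σ * L) ^ (m - 1) ≤ c / 2 * L ^ (m - 1) := fun m C c hm hC hc => by
    refine (mul_le_mul_of_nonneg_left (hpow m hm) hC).trans ?_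
    rw [← mul_assoc]
    exact mul_le_mul_of_nonneg_right hc (Real.rpow_nonneg hL0 _)
  rcases ae_le_or_rpow_le hN hs0 hs1 hq hqp hR hℓ hL0 hu0 hup huq htest
    (Hp R _ u hR hℓ hu0 hup hip) (Hq R _ u hR hℓ hu0 huq hiq) hcp hcq hLp hLq
    (hbound p Cp cp hp hCp hσp) (hbound q Cq cq hq hCq hσq) with h | h
  · refine (by linarith : _ ≤ σ * L).trans (le_essInf_of_ae_le_real hball ?_)
    filter_upwards [ae_restrict_of_ae h, ae_restrict_mem measurableSet_ball] with x hx hxb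
    rwa [barrier_eq hR (by simpa using (mem_ball_zero_iff.1 hxb).le)] at hx
  · refine le_trans ?_ (le_essInf_of_ae_le_real hball (.of_forall hu0))
    rw [sub_nonpos, ← Real.mul_rpow (by positivity) (by positivity)]
    have h' := Real.rpow_le_rpow (by positivity) h (show 0 ≤ 1 / (p - 1) from
      one_div_nonneg.2 (by linarith))
    rw [← Real.rpow_mul hL0, mul_one_div_cancel (by linarith), Real.rpow_one] at h'
    exact (mul_le_of_le_one_left hL0 (by linarith)).trans h'

end FracPQ

/-! ### The weak Harnack inequality for functions nonnegative almost everywhere -/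

open FracPQ in
theorem theorem3p1 (N : ℕ) (hN : 1 ≤ N) (s p q : ℝ) (hs0 : 0 < s) (hs1 : s < 1)
    (hq : 2 ≤ q) (hqp : q ≤ p) :
    ∃ σ C : ℝ, 0 < σ ∧ σ < 1 ∧ 0 < C ∧
      ∀ (R K : ℝ) (u : FracPQ.Space N → ℝ), 0 < R → 0 ≤ K →
        (∀ᵐ x : FracPQ.Space N, 0 ≤ u x) →
        FracPQ.IsWeakSupersolution s p q (Metric.ball 0 (R / 3)) (fun _ => -K) u →
          σ * (⨍ x in Metric.ball (0 : FracPQ.Space N) R \ Metric.ball 0 (R / 2),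
                u x ^ (q - 1)) ^ (1 / (q - 1))
              - C * (K * R ^ (s * p)) ^ (1 / (p - 1))
            ≤ essInf u (volume.restrict (Metric.ball (0 : FracPQ.Space N) (R / 4))) := by
  obtain ⟨σ, C, hσ0, hσ1, hC, H⟩ := weak_harnack_of_measurable N hN s p q hs0 hs1 hq hqp
  refine ⟨σ, C, hσ0, hσ1, hC, fun R K u hR hK hu ⟨hup, huq, htest⟩ => ?_⟩
  have hp : 2 ≤ p := hq.trans hqp
  have hmeas := hup.1.aemeasurable
  -- The Fubini arguments use a measurable, everywhere nonnegative function; the weak form, the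
  -- average and the essential infimum do not see the change on a null set.
  let v : Space N → ℝ := fun x => max (hmeas.mk u x) 0
  have hv : Measurable v := hmeas.measurable_mk.max measurable_const
  have hv0 : ∀ x, 0 ≤ v x := fun x => le_max_right _ _
  have huv : u =ᵐ[volume] v := by
    filter_upwards [hmeas.ae_eq_mk, hu] with x h1 h2
    simp only [v]
    rw [← h1, max_eq_left h2]
  have hint : ∀ m : ℝ, 2 ≤ m → MemLmLoc m u →
      IntegrableOn (fun y => v y ^ (m - 1)) (annulus N R) := fun m hm h => by
    have hsub : annulus N R ⊆ Metric.closedBall 0 R :=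
      Set.sdiff_subset.trans Metric.ball_subset_closedBall
    refine ((h.integrableOn_rpow hm huv (isCompact_closedBall (0 : Space N) R)).mono_set
      hsub).congr (.of_forall fun y => ?_)
    simp only
    rw [abs_of_nonneg (hv0 y)]
  have h := H R K v hR hK hv0
    (hup.admissible hp hs0 (by positivity) (by linarith) huv hv)
    (huq.admissible hq hs0 (by positivity) (by linarith) huv hv)
    (hint p hp hup.1) (hint q hq huq.1)
    (fun φ hφ hφ0 => by
      rw [← weakForm_congr φ huv, ← weakForm_congr φ huv]
      exact htest φ hφ hφ0)
  have havg : ⨍ x in Metric.ball (0 : Space N) R \ Metric.ball 0 (R / 2), u x ^ (q - 1) =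
      ⨍ y in annulus N R, v y ^ (q - 1) := by
    refine average_congr (ae_restrict_of_ae ?_)
    filter_upwards [huv] with x hx
    rw [hx]
  rw [havg, essInf_congr_ae (ae_restrict_of_ae huv)]
  exact h
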